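/- Let $k \ge 1$ and let $p_1,\ldots,p_k$ be distinct prime numbers. For a prime $p$ let $|\cdot|_p$ denote the $p$-adic absolute value, normalised by $|p|_p = 1/p$, and let $\|x\|$ denote the distance from a real number $x$ to the nearest integer. Let $\mathbb{N} = \{1,2,3,\ldots\}$. (i) Let $\psi : \mathbb{N} \to \mathbb{R}$ be a non-negative (not necessarily strictly) decreasing function. If $\sum_{n \in \mathbb{N}} (\log n)^k \psi(n)$ diverges, then for Lebesgue-almost every real number $\alpha$ the inequality $$|n|_{p_1} \cdots |n|_{p_k} \, \|n\alpha\| \le \psi(n)$$ has infinitely many solutions $n \in \mathbb{N}$. If the sum converges, then for Lebesgue-almost every real number $\alpha$ this inequality has only finitely many solutions $n \in \mathbb{N}$. (ii) Consequently, for Lebesgue-almost every real number $\alpha$, $$\liminf_{n \to \infty} \; n \, (\log n)^{k+1} \, |n|_{p_1} \cdots |n|_{p_k} \, \|n\alpha\| = 0 .$$ -/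

import Mathlib

open MeasureTheory Filter

/-- The distance `‖x‖` from a real number `x` to the nearest integer. -/
noncomputable def distNearestInt (x : ℝ) : ℝ :=
  |x - (round x : ℝ)|

/-- The mixed quantity `|n|_{p_1} ⋯ |n|_{p_k} ‖n α‖`, where `|n|_p` is the usual `p`-adic absolute
value (normalised by `|p|_p = 1 / p`) and `‖·‖` is the distance to the nearest integer. -/
noncomputable def mixedProd {k : ℕ} (p : Fin k → ℕ) (α : ℝ) (n : ℕ) : ℝ :=
  (∏ i, ((padicNorm (p i) (n : ℚ) : ℚ) : ℝ)) * distNearestInt ((n : ℝ) * α)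

/-- The positive integers `n` with `|n|_{p_1} ⋯ |n|_{p_k} ‖n α‖ ≤ ψ n`. -/
def mixedSolutions {k : ℕ} (p : Fin k → ℕ) (ψ : ℕ → ℝ) (α : ℝ) : Set ℕ :=
  {n : ℕ | 1 ≤ n ∧ mixedProd p α n ≤ ψ n}

/-!
Write `S n = ∏ i, p i ^ v_{p i} n` for the part of `n` composed of the primes `p i`. Since
`∏ i, |n|_{p i} = 1 / S n`, the inequality reads `‖n α‖ ≤ S n * ψ n`: a Khinchin problem for the
non-monotonic approximating function `Ψ n = S n * ψ n`.

*Averages of `S`.* Grouping `n ≤ N` by the exponents `v i` of the `p i` gives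
`∑ S n ≪ N (log N) ^ k` and `∑ (φ n / n) S n ≫ N (log N) ^ k`. The second bound takes the exponents
with `p i ^ (k * v i) ≤ N` and uses that `φ m / m` has positive mean over the `m` coprime to
all `p i`, already over the progression `m ≡ 1 mod 2 ∏ p i`. Summation by parts against the
decreasing `ψ` then shows that `∑ S n ψ n` and `∑ (φ n / n) S n ψ n` are both comparable to
`∑ (log n) ^ k ψ n` (`sum_primePart_le_sum_log_pow`, `sum_totient_div_mul_primePart_ge`,
`sum_mul_le_sum_mul_of_antitone`).

*Convergence.* The set `{‖n α‖ ≤ Ψ n}` has measure at most `2 Ψ n` on the circle, so the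
Borel-Cantelli lemma applies.

*Divergence.* If `Ψ n > 1 / 2` infinitely often there is nothing to prove. Otherwise let `E n` be
the set of points of the circle within `Ψ n / n` of a point of exact order `n`. Then `E n` has
measure `2 φ n Ψ n / n`, while `E m ∩ E n` has measure at most `8 Ψ m Ψ n` for `m ≠ n`, because
torsion points are well separated (`volume_real_inter_approxAddOrderOf_le`). As `∑ Ψ` and
`∑ (φ n / n) Ψ n` are comparable, a second moment argument (`measure_frequently_mem_ne_zero`) shows
that almost surely lying in only finitely many `E n` is impossible, and Gallagher's zero-one law
upgrades this to almost every point lying in infinitely many: this is the Duffin-Schaeffer theorem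
`duffin_schaeffer`.

The statement on the lower limit is the divergence case for the functions
`ψ n = ε / (n (log n) ^ (k + 1))`, because `∑ 1 / (n log n)` diverges.
-/

/-! ### Neighbourhoods of torsion points on the circle -/

theorem UnitAddCircle.volume_real_ball (x : UnitAddCircle) (ε : ℝ) (hε : 0 ≤ ε) :
    volume.real (Metric.ball x ε) = min 1 (2 * ε) := by
  rw [← measureReal_congr AddCircle.closedBall_ae_eq_ball, Measure.real,
    AddCircle.volume_closedBall, ENNReal.toReal_ofReal (by positivity)]

theorem UnitAddCircle.one_le_mul_norm {n : ℕ} (hn : 0 < n) {u : UnitAddCircle} (hu : n • u = 0)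
    (h0 : u ≠ 0) : 1 ≤ n * ‖u‖ := by
  have hfin : IsOfFinAddOrder u := isOfFinAddOrder_iff_nsmul_eq_zero.2 ⟨n, hn, hu⟩
  have h := AddCircle.le_add_order_smul_norm_of_isOfFinAddOrder hfin h0
  rw [nsmul_eq_mul] at h
  refine h.trans ?_
  gcongr
  exact Nat.le_of_dvd hn (addOrderOf_dvd_of_nsmul_eq_zero hu)

theorem UnitAddCircle.pairwiseDisjoint_ball {n : ℕ} (hn : 0 < n) {A : Set UnitAddCircle}
    (hA : ∀ x ∈ A, ∀ y ∈ A, n • (x - y) = 0) {δ : ℝ} (hδ : n * δ ≤ 1 / 2) :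
    A.PairwiseDisjoint fun x => Metric.ball x δ := by
  intro x hx y hy hxy
  apply Metric.ball_disjoint_ball
  have h := one_le_mul_norm hn (hA x hx y hy) (sub_ne_zero.2 hxy)
  rw [dist_eq_norm]
  have hn' : (0 : ℝ) < n := by exact_mod_cast hn
  by_contra! hlt
  nlinarith

/-- Packing bound: the balls of radius `1 / (2 * n)` around points that differ by `n`-torsion are
disjoint, and the circle has measure one. -/
theorem UnitAddCircle.card_le_of_nsmul_sub_eq_zero {n : ℕ} (hn : 0 < n)
    {A : Finset UnitAddCircle} (hA : ∀ x ∈ A, ∀ y ∈ A, n • (x - y) = 0) : A.card ≤ n := by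
  have hn' : (0 : ℝ) < n := by exact_mod_cast hn
  have hn1 : (1 : ℝ) ≤ n := by exact_mod_cast hn
  have hd := pairwiseDisjoint_ball hn (A := (A : Set UnitAddCircle))
    (fun x hx y hy => hA x (by simpa using hx) y (by simpa using hy))
    (δ := 1 / (2 * n)) (by field_simp; rfl)
  have h := measureReal_biUnion_finset (μ := volume) hd fun _ _ => measurableSet_ball
  have h1 : volume.real (⋃ x ∈ A, Metric.ball x (1 / (2 * (n : ℝ)))) ≤ 1 := by
    refine (measureReal_mono (Set.subset_univ _)).trans ?_
    simp [Measure.real]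
  have h2 : min 1 (2 * (1 / (2 * (n : ℝ)))) = 1 / n := by
    rw [min_eq_right] <;> field_simp
    assumption
  rw [h, Finset.sum_congr rfl fun x _ => volume_real_ball x _ (by positivity), h2] at h1
  simp only [Finset.sum_const, nsmul_eq_mul] at h1
  rw [mul_one_div, div_le_one hn'] at h1
  exact_mod_cast h1

/-- Local version of the packing bound, comparing with the measure of a ball of radius
`r + 1 / (2 * n)`. The `+ 1` accounts for the point `0` itself. -/
theorem UnitAddCircle.card_le_of_norm_lt {n : ℕ} (hn : 0 < n)
    {A : Finset UnitAddCircle} (hA : ∀ x ∈ A, ∀ y ∈ A, n • (x - y) = 0) {r : ℝ} (hr : 0 ≤ r)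
    (hAr : ∀ x ∈ A, ‖x‖ < r) : (A.card : ℝ) ≤ 2 * r * n + 1 := by
  have hn' : (0 : ℝ) < n := by exact_mod_cast hn
  have hn1 : (1 : ℝ) ≤ n := by exact_mod_cast hn
  have hd := pairwiseDisjoint_ball hn (A := (A : Set UnitAddCircle))
    (fun x hx y hy => hA x (by simpa using hx) y (by simpa using hy))
    (δ := 1 / (2 * n)) (by field_simp; rfl)
  have h := measureReal_biUnion_finset (μ := volume) hd fun _ _ => measurableSet_ball
  have h1 : volume.real (⋃ x ∈ A, Metric.ball x (1 / (2 * (n : ℝ)))) ≤ 2 * (r + 1 / (2 * n)) := by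
    refine (measureReal_mono (s₂ := Metric.ball 0 (r + 1 / (2 * n))) ?_).trans ?_
    · simp only [Set.iUnion_subset_iff]
      intro x hx
      apply Metric.ball_subset
      rw [dist_zero_right]
      linarith [hAr x hx]
    · rw [volume_real_ball _ _ (by positivity)]
      exact min_le_right _ _
  have h2 : min 1 (2 * (1 / (2 * (n : ℝ)))) = 1 / n := by
    rw [min_eq_right] <;> field_simp
    assumption
  rw [h, Finset.sum_congr rfl fun x _ => volume_real_ball x _ (by positivity), h2] at h1
  simp only [Finset.sum_const, nsmul_eq_mul] at h1
  rw [mul_one_div, div_le_iff₀ hn'] at h1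
  refine h1.trans (le_of_eq ?_)
  field_simp

/-- The points of exact additive order `n` on the circle, that is, the reduced fractions `a / n`. -/
noncomputable def pointsOfOrder {n : ℕ} (hn : 0 < n) : Finset UnitAddCircle :=
  (AddCircle.finite_setOfPred_addOrderOf_eq 1 hn).toFinset

theorem mem_pointsOfOrder {n : ℕ} (hn : 0 < n) {x : UnitAddCircle} :
    x ∈ pointsOfOrder hn ↔ addOrderOf x = n := by
  simp [pointsOfOrder]

theorem card_pointsOfOrder {n : ℕ} (hn : 0 < n) : (pointsOfOrder hn).card = n.totient := by
  rw [← AddCircle.card_addOrderOf_eq_totient (p := (1 : ℝ)) (n := n)]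
  rw [pointsOfOrder, ← Nat.card_eq_card_finite_toFinset]
  rfl

theorem nsmul_eq_zero_of_mem_pointsOfOrder {n : ℕ} (hn : 0 < n) {x : UnitAddCircle}
    (hx : x ∈ pointsOfOrder hn) : n • x = 0 := by
  rw [← (mem_pointsOfOrder hn).1 hx]; exact addOrderOf_nsmul_eq_zero x

theorem approxAddOrderOf_eq_biUnion {n : ℕ} (hn : 0 < n) (δ : ℝ) :
    approxAddOrderOf UnitAddCircle n δ = ⋃ x ∈ pointsOfOrder hn, Metric.ball x δ := by
  rw [approxAddOrderOf, Metric.thickening_eq_biUnion_ball]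
  simp [mem_pointsOfOrder]

theorem volume_real_approxAddOrderOf {n : ℕ} (hn : 0 < n) {δ : ℝ} (h0 : 0 ≤ δ)
    (hδ : n * δ ≤ 1 / 2) :
    volume.real (approxAddOrderOf UnitAddCircle n δ) = n.totient * (2 * δ) := by
  have hn1 : (1 : ℝ) ≤ n := by exact_mod_cast hn
  rw [approxAddOrderOf_eq_biUnion hn, measureReal_biUnion_finset
    (UnitAddCircle.pairwiseDisjoint_ball hn ?_ hδ) fun _ _ => measurableSet_ball,
    Finset.sum_congr rfl fun x _ => UnitAddCircle.volume_real_ball x _ h0,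
    min_eq_right (by nlinarith), Finset.sum_const, card_pointsOfOrder, nsmul_eq_mul]
  intro x hx y hy
  rw [smul_sub, nsmul_eq_zero_of_mem_pointsOfOrder hn hx,
    nsmul_eq_zero_of_mem_pointsOfOrder hn hy, sub_zero]

/-- A difference of a point of order `m` and one of order `n` is a nonzero `lcm m n`-torsion point,
and it arises from at most `gcd m n` pairs. -/
theorem card_close_pairs_le {m n : ℕ} (hm : 0 < m) (hn : 0 < n) (hmn : m ≠ n) {r : ℝ}
    (hr : 0 < r) :
    ((((pointsOfOrder hm) ×ˢ (pointsOfOrder hn)).filter fun q => ‖q.1 - q.2‖ < r).card : ℝ) ≤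
      2 * r * (m * n) := by
  classical
  set P := ((pointsOfOrder hm) ×ˢ (pointsOfOrder hn)).filter fun q => ‖q.1 - q.2‖ < r with hP
  have hP' : ∀ q ∈ P, (addOrderOf q.1 = m ∧ addOrderOf q.2 = n) ∧ ‖q.1 - q.2‖ < r := by
    intro q hq
    simpa [hP, mem_pointsOfOrder] using hq
  have hPm : ∀ q ∈ P, m • q.1 = 0 := fun q hq => by
    rw [← (hP' q hq).1.1]; exact addOrderOf_nsmul_eq_zero _
  have hPn : ∀ q ∈ P, n • q.2 = 0 := fun q hq => by
    rw [← (hP' q hq).1.2]; exact addOrderOf_nsmul_eq_zero _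
  have hfib : P.card ≤ m.gcd n * (P.image fun q => q.1 - q.2).card := by
    apply Finset.card_le_mul_card_image
    intro z _
    -- On a fibre, first coordinates differ by elements killed by both `m` and `n`.
    have hinj : Set.InjOn (fun q : UnitAddCircle × UnitAddCircle => q.1)
        (P.filter fun q => q.1 - q.2 = z) := by
      intro q hq q' hq' h
      simp only [Finset.coe_filter, Set.mem_ofPred_eq] at hq hq'
      dsimp only at h
      have : q.2 = q'.2 := by
        have := hq.2.trans hq'.2.symm
        rw [h] at this
        exact sub_right_injective this
      exact Prod.ext h this
    rw [← Finset.card_image_of_injOn hinj]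
    apply UnitAddCircle.card_le_of_nsmul_sub_eq_zero (Nat.gcd_pos_of_pos_left _ hm)
    intro x hx y hy
    simp only [Finset.mem_image, Finset.mem_filter] at hx hy
    obtain ⟨q, ⟨hq, hqz⟩, rfl⟩ := hx
    obtain ⟨q', ⟨hq', hqz'⟩, rfl⟩ := hy
    have e1 : m • (q.1 - q'.1) = 0 := by rw [smul_sub, hPm q hq, hPm q' hq', sub_zero]
    have e2 : n • (q.1 - q'.1) = 0 := by
      have : q.1 - q'.1 = q.2 - q'.2 := by
        rw [sub_eq_sub_iff_sub_eq_sub]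
        exact hqz.trans hqz'.symm
      rw [this, smul_sub, hPn q hq, hPn q' hq', sub_zero]
    exact addOrderOf_dvd_iff_nsmul_eq_zero.1
      (Nat.dvd_gcd (addOrderOf_dvd_of_nsmul_eq_zero e1) (addOrderOf_dvd_of_nsmul_eq_zero e2))
  have h0 : (0 : UnitAddCircle) ∉ P.image fun q => q.1 - q.2 := by
    simp only [Finset.mem_image, not_exists, not_and]
    intro q hq h
    rw [sub_eq_zero] at h
    have := hP' q hq
    rw [h] at this
    exact hmn (this.1.1.symm.trans this.1.2)
  have hlcm : ∀ x ∈ insert 0 (P.image fun q => q.1 - q.2), m.lcm n • x = 0 := by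
    intro x hx
    rw [Finset.mem_insert, Finset.mem_image] at hx
    rcases hx with rfl | ⟨q, hq, rfl⟩
    · simp
    · obtain ⟨a, ha⟩ := Nat.dvd_lcm_left m n
      obtain ⟨b, hb⟩ := Nat.dvd_lcm_right m n
      rw [smul_sub]
      nth_rewrite 1 [ha]
      rw [hb, mul_comm m, mul_comm n, mul_smul, mul_smul, hPm q hq, hPn q hq]
      simp
  have hZ := UnitAddCircle.card_le_of_norm_lt (Nat.lcm_pos hm hn)
    (A := insert 0 (P.image fun q => q.1 - q.2))
    (fun x hx y hy => by rw [smul_sub, hlcm x hx, hlcm y hy, sub_zero]) hr.le (by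
      intro x hx
      rw [Finset.mem_insert, Finset.mem_image] at hx
      rcases hx with rfl | ⟨q, hq, rfl⟩
      · simpa
      · exact (hP' q hq).2)
  rw [Finset.card_insert_of_notMem h0] at hZ
  push_cast at hZ
  have hZ' : ((P.image fun q => q.1 - q.2).card : ℝ) ≤ 2 * r * (m.lcm n) := by linarith
  calc (P.card : ℝ) ≤ (m.gcd n : ℝ) * (P.image fun q => q.1 - q.2).card := by exact_mod_cast hfib
    _ ≤ (m.gcd n : ℝ) * (2 * r * (m.lcm n)) := by gcongr
    _ = 2 * r * ((m.gcd n * m.lcm n : ℕ) : ℝ) := by push_cast; ring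
    _ = 2 * r * (m * n) := by rw [Nat.gcd_mul_lcm]; push_cast; ring

/-- Quasi-independence: up to the constant, the overlap is the product of the measures that full
neighbourhoods of all fractions with denominators `m` and `n` would have. -/
theorem volume_real_inter_approxAddOrderOf_le {m n : ℕ} (hm : 0 < m) (hn : 0 < n) (hmn : m ≠ n)
    {δ ε : ℝ} (hδ : 0 ≤ δ) (hε : 0 ≤ ε) :
    volume.real (approxAddOrderOf UnitAddCircle m δ ∩ approxAddOrderOf UnitAddCircle n ε) ≤
      8 * (m * δ) * (n * ε) := by
  rcases hδ.eq_or_lt with rfl | hδ'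
  · simp [approxAddOrderOf_eq_biUnion hm]
  rcases hε.eq_or_lt with rfl | hε'
  · simp [approxAddOrderOf_eq_biUnion hn]
  set P := ((pointsOfOrder hm) ×ˢ (pointsOfOrder hn)).filter fun q => ‖q.1 - q.2‖ < δ + ε with hP
  have hsub : approxAddOrderOf UnitAddCircle m δ ∩ approxAddOrderOf UnitAddCircle n ε ⊆
      ⋃ q ∈ P, Metric.ball q.1 δ ∩ Metric.ball q.2 ε := by
    rw [approxAddOrderOf_eq_biUnion hm, approxAddOrderOf_eq_biUnion hn]
    rintro z ⟨h1, h2⟩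
    simp only [Set.mem_iUnion, exists_prop] at h1 h2 ⊢
    obtain ⟨x, hx, hzx⟩ := h1
    obtain ⟨y, hy, hzy⟩ := h2
    refine ⟨(x, y), ?_, hzx, hzy⟩
    simp only [hP, Finset.mem_filter, Finset.mem_product]
    refine ⟨⟨hx, hy⟩, ?_⟩
    rw [← dist_eq_norm]
    rw [Metric.mem_ball] at hzx hzy
    rw [dist_comm] at hzx
    linarith [dist_triangle x z y]
  -- `min δ ε * max δ ε = δ * ε` and `δ + ε ≤ 2 * max δ ε`.
  have hmin : min δ ε * (δ + ε) ≤ 2 * (δ * ε) := by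
    rcases le_total δ ε with h | h
    · rw [min_eq_left h]; nlinarith
    · rw [min_eq_right h]; nlinarith
  calc _ ≤ volume.real (⋃ q ∈ P, Metric.ball q.1 δ ∩ Metric.ball q.2 ε) :=
        measureReal_mono hsub (measure_ne_top _ _)
    _ ≤ ∑ q ∈ P, volume.real (Metric.ball q.1 δ ∩ Metric.ball q.2 ε) :=
        measureReal_biUnion_finset_le _ _
    _ ≤ ∑ q ∈ P, 2 * min δ ε := by
        refine Finset.sum_le_sum fun q _ => ?_
        rw [mul_min_of_nonneg _ _ zero_le_two]
        refine le_min ?_ ?_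
        · refine (measureReal_mono Set.inter_subset_left).trans ?_
          rw [UnitAddCircle.volume_real_ball _ _ hδ]
          exact min_le_right _ _
        · refine (measureReal_mono Set.inter_subset_right).trans ?_
          rw [UnitAddCircle.volume_real_ball _ _ hε]
          exact min_le_right _ _
    _ = P.card * (2 * min δ ε) := by rw [Finset.sum_const, nsmul_eq_mul]
    _ ≤ (2 * (δ + ε) * (m * n)) * (2 * min δ ε) := by
        have := card_close_pairs_le hm hn hmn (r := δ + ε) (by positivity)
        gcongr
    _ = 4 * (m * n) * (min δ ε * (δ + ε)) := by ring
    _ ≤ 4 * (m * n) * (2 * (δ * ε)) := by gcongr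
    _ = _ := by ring

/-! ### A second moment criterion for limsup sets -/

/-- The Cauchy-Schwarz inequality `(∫ Z) ^ 2 ≤ μ U * ∫ Z ^ 2` for the counting function `Z` of the
sets `E i`, which is supported in `U`. -/
theorem sq_sum_measureReal_le {X ι : Type*} [MeasurableSpace X] (μ : Measure X)
    [IsFiniteMeasure μ] (s : Finset ι) {E : ι → Set X} (hE : ∀ i ∈ s, MeasurableSet (E i))
    {U : Set X} (hU : MeasurableSet U) (hEU : ∀ i ∈ s, E i ⊆ U) :
    (∑ i ∈ s, μ.real (E i)) ^ 2 ≤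
      μ.real U * ∑ i ∈ s, ∑ j ∈ s, μ.real (E i ∩ E j) := by
  -- The quadratic polynomial `∫ (Z - t * 1_U) ^ 2` in `t` is nonnegative.
  have key : ∀ t : ℝ, 0 ≤ μ.real U * (t * t) + (-2 * ∑ i ∈ s, μ.real (E i)) * t +
      ∑ i ∈ s, ∑ j ∈ s, μ.real (E i ∩ E j) := by
    intro t
    have hint : ∀ A : Set X, MeasurableSet A → Integrable (A.indicator (1 : X → ℝ)) μ :=
      fun A hA => (integrable_const (1 : ℝ)).indicator hA
    have hpt : ∀ x, ((∑ i ∈ s, (E i).indicator (1 : X → ℝ) x) - t * U.indicator 1 x) ^ 2 =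
        (t * t) * U.indicator (1 : X → ℝ) x + (-2 * t) * (∑ i ∈ s, (E i).indicator (1 : X → ℝ) x) +
        ∑ i ∈ s, ∑ j ∈ s, (E i ∩ E j).indicator (1 : X → ℝ) x := by
      intro x
      have h1 : ∀ i j, (E i ∩ E j).indicator (1 : X → ℝ) x =
          (E i).indicator (1 : X → ℝ) x * (E j).indicator (1 : X → ℝ) x := by
        intro i j; rw [Set.inter_indicator_one]; rfl
      simp_rw [h1, ← Finset.sum_mul_sum]
      by_cases hx : x ∈ U
      · simp only [Set.indicator_of_mem hx, Pi.one_apply]; ring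
      · have : ∀ i ∈ s, (E i).indicator (1 : X → ℝ) x = 0 := fun i hi =>
          Set.indicator_of_notMem (fun h => hx (hEU i hi h)) _
        rw [Finset.sum_eq_zero this]
        simp [Set.indicator_of_notMem hx]
    have h0 : 0 ≤ ∫ x, ((∑ i ∈ s, (E i).indicator (1 : X → ℝ) x) - t * U.indicator 1 x) ^ 2 ∂μ :=
      integral_nonneg fun x => sq_nonneg _
    have i1 : Integrable (fun x => (t * t) * U.indicator (1 : X → ℝ) x) μ :=
      (hint U hU).const_mul _
    have i2' : Integrable (fun x => ∑ i ∈ s, (E i).indicator (1 : X → ℝ) x) μ :=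
      integrable_finsetSum _ fun i hi => hint _ (hE i hi)
    have i2 : Integrable (fun x => (-2 * t) * (∑ i ∈ s, (E i).indicator (1 : X → ℝ) x)) μ :=
      i2'.const_mul _
    have i3' : ∀ i ∈ s, Integrable (fun x => ∑ j ∈ s, (E i ∩ E j).indicator (1 : X → ℝ) x) μ :=
      fun i hi => integrable_finsetSum _ fun j hj => hint _ ((hE i hi).inter (hE j hj))
    have i3 : Integrable (fun x => ∑ i ∈ s, ∑ j ∈ s, (E i ∩ E j).indicator (1 : X → ℝ) x) μ :=
      integrable_finsetSum _ i3'
    simp_rw [hpt] at h0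
    rw [integral_add (by exact i1.add i2) i3, integral_add i1 i2, integral_const_mul, integral_const_mul,
      integral_indicator_one hU, integral_finsetSum _ fun i hi => hint _ (hE i hi),
      integral_finsetSum _ i3'] at h0
    rw [Finset.sum_congr rfl fun i hi => integral_indicator_one (hE i hi)] at h0
    have e3 : ∑ i ∈ s, ∫ x, ∑ j ∈ s, (E i ∩ E j).indicator (1 : X → ℝ) x ∂μ =
        ∑ i ∈ s, ∑ j ∈ s, μ.real (E i ∩ E j) := by
      refine Finset.sum_congr rfl fun i hi => ?_
      rw [integral_finsetSum _ fun j hj => hint _ ((hE i hi).inter (hE j hj))]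
      exact Finset.sum_congr rfl fun j hj => integral_indicator_one ((hE i hi).inter (hE j hj))
    rw [e3] at h0
    linarith
  have := discrim_le_zero key
  rw [discrim] at this
  nlinarith

/-- Divergence part of the Borel-Cantelli lemma under quasi-independence on average: points lying in
infinitely many of the `E n` do not form a null set. -/
theorem measure_frequently_mem_ne_zero {X : Type*} [MeasurableSpace X] (μ : Measure X)
    [IsProbabilityMeasure μ] {E : ℕ → Set X} (hE : ∀ n, MeasurableSet (E n))
    (hdiv : Tendsto (fun N => ∑ n ∈ Finset.range N, μ.real (E n)) atTop atTop) {K : ℝ}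
    (hK : ∀ᶠ N in atTop, ∑ m ∈ Finset.range N, ∑ n ∈ Finset.range N, μ.real (E m ∩ E n) ≤
      K * (∑ n ∈ Finset.range N, μ.real (E n)) ^ 2) :
    ¬ ∀ᵐ x ∂μ, ¬ ∃ᶠ n in atTop, x ∈ E n := by
  intro hae
  set U : ℕ → Set X := fun m => ⋃ n ≥ m, E n with hUdef
  have hUm : ∀ m, MeasurableSet (U m) := fun m =>
    MeasurableSet.iUnion fun n => MeasurableSet.iUnion fun _ => hE n
  have hanti : Antitone U := fun a b hab => by
    intro x hx
    simp only [hUdef, Set.mem_iUnion] at hx ⊢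
    obtain ⟨n, hn, hx⟩ := hx
    exact ⟨n, hab.trans hn, hx⟩
  have hlim : Tendsto (fun m => μ.real (U m)) atTop (nhds 0) := by
    have h := tendsto_measure_iInter_atTop (μ := μ) (s := U)
      (fun m => (hUm m).nullMeasurableSet) hanti ⟨0, measure_ne_top _ _⟩
    have h0 : μ (⋂ m, U m) = 0 := by
      refine measure_mono_null ?_ (ae_iff.1 hae)
      intro x hx
      simp only [Set.mem_ofPred_eq, not_not]
      rw [frequently_atTop]
      intro a
      have := Set.mem_iInter.1 hx a
      simp only [hUdef, Set.mem_iUnion] at this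
      obtain ⟨n, hn, hx⟩ := this
      exact ⟨n, hn, hx⟩
    rw [h0] at h
    exact (ENNReal.tendsto_toReal ENNReal.zero_ne_top).comp h
  have hlim' : Tendsto (fun m => 4 * K * μ.real (U m)) atTop (nhds 0) := by
    simpa using hlim.const_mul (4 * K)
  -- If the limsup set were null, some tail `U m` would be so small that Cauchy-Schwarz fails.
  obtain ⟨m, hm⟩ := (hlim'.eventually (gt_mem_nhds zero_lt_one)).exists
  set c := ∑ n ∈ Finset.range m, μ.real (E n) with hc
  obtain ⟨N, hKN, hN, hmN⟩ := (hK.and ((hdiv.eventually_ge_atTop (2 * c + 1)).and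
    (eventually_ge_atTop m))).exists
  set S := ∑ n ∈ Finset.range N, μ.real (E n) with hS
  have hc0 : 0 ≤ c := Finset.sum_nonneg fun _ _ => measureReal_nonneg
  have hsplit : c + ∑ n ∈ Finset.Ico m N, μ.real (E n) = S :=
    Finset.sum_range_add_sum_Ico _ hmN
  have hcs := sq_sum_measureReal_le μ (Finset.Ico m N) (fun i _ => hE i) (hUm m)
    (fun i hi => Set.subset_iUnion₂_of_subset i (Finset.mem_Ico.1 hi).1 subset_rfl)
  have hsubset : Finset.Ico m N ⊆ Finset.range N := fun i hi => by
    simp at hi ⊢; exact hi.2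
  have hle : ∑ i ∈ Finset.Ico m N, ∑ j ∈ Finset.Ico m N, μ.real (E i ∩ E j) ≤ K * S ^ 2 := by
    refine le_trans ?_ hKN
    refine (Finset.sum_le_sum fun i _ => Finset.sum_le_sum_of_subset_of_nonneg hsubset
      fun _ _ _ => measureReal_nonneg).trans ?_
    exact Finset.sum_le_sum_of_subset_of_nonneg hsubset
      fun _ _ _ => Finset.sum_nonneg fun _ _ => measureReal_nonneg
  have h1 : (S / 2) ^ 2 ≤ (∑ n ∈ Finset.Ico m N, μ.real (E n)) ^ 2 := by
    apply pow_le_pow_left₀ <;> linarith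
  have h2 : (S / 2) ^ 2 ≤ μ.real (U m) * (K * S ^ 2) :=
    h1.trans (hcs.trans (mul_le_mul_of_nonneg_left hle measureReal_nonneg))
  have hS2 : 0 < S ^ 2 := pow_pos (by linarith) 2
  nlinarith

/-! ### The Duffin-Schaeffer theorem -/

/-- **Duffin-Schaeffer theorem**: if `∑ φ n / n * Ψ n` diverges and has partial sums comparable to
those of `∑ Ψ n`, then `‖n • x‖ < Ψ n` infinitely often for almost every `x`. All sums run over
`n = i + 1`, so `Ψ 0` plays no role in them. -/
theorem duffin_schaeffer {Ψ : ℕ → ℝ} (h0 : ∀ n, 0 ≤ Ψ n) (h1 : ∀ n, Ψ n ≤ 1 / 2)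
    (hdiv : Tendsto (fun N => ∑ i ∈ Finset.range N,
      ((i + 1).totient : ℝ) / (i + 1 : ℕ) * Ψ (i + 1)) atTop atTop) {C : ℝ}
    (hC : ∀ᶠ N in atTop, ∑ i ∈ Finset.range N, Ψ (i + 1) ≤
      C * ∑ i ∈ Finset.range N, ((i + 1).totient : ℝ) / (i + 1 : ℕ) * Ψ (i + 1)) :
    ∀ᵐ x : UnitAddCircle, ∃ᶠ n : ℕ in atTop, 0 < n ∧ ‖n • x‖ < Ψ n := by
  set δ : ℕ → ℝ := fun n => Ψ n / n with hδ
  have hδ0 : ∀ n, 0 ≤ δ n := fun n => div_nonneg (h0 n) (Nat.cast_nonneg n)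
  have hnδ : ∀ i : ℕ, ((i + 1 : ℕ) : ℝ) * δ (i + 1) = Ψ (i + 1) := fun i => by
    rw [hδ]; exact mul_div_cancel₀ _ (by positivity)
  have hδlim : Tendsto δ atTop (nhds 0) := by
    refine squeeze_zero hδ0 (fun n => ?_) (tendsto_one_div_atTop_nhds_zero_nat (𝕜 := ℝ))
    exact div_le_div_of_nonneg_right ((h1 n).trans (by norm_num)) (Nat.cast_nonneg n)
  set E : ℕ → Set UnitAddCircle := fun i => approxAddOrderOf UnitAddCircle (i + 1) (δ (i + 1))
    with hE
  have hEm : ∀ i, MeasurableSet (E i) := fun i => Metric.isOpen_thickening.measurableSet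
  have hmem : ∀ x, x ∈ addWellApproximable UnitAddCircle δ ↔ ∃ᶠ i in atTop, x ∈ E i := by
    intro x
    rw [UnitAddCircle.mem_addWellApproximable_iff, ← Nat.frequently_atTop_iff_infinite]
    constructor
    · intro h
      rw [frequently_atTop] at h ⊢
      intro a
      obtain ⟨n, hn, m, hm, hx⟩ := h (a + 1)
      obtain ⟨i, rfl⟩ : ∃ i, n = i + 1 := ⟨n - 1, by omega⟩
      exact ⟨i, by omega, (UnitAddCircle.mem_approxAddOrderOf_iff (by omega)).2 ⟨m, hm, hx⟩⟩
    · intro h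
      rw [frequently_atTop] at h ⊢
      intro a
      obtain ⟨i, hi, hx⟩ := h a
      exact ⟨i + 1, by omega, (UnitAddCircle.mem_approxAddOrderOf_iff (by omega)).1 hx⟩
  have hvol : ∀ i, volume.real (E i) =
      2 * (((i + 1).totient : ℝ) / (i + 1 : ℕ) * Ψ (i + 1)) := by
    intro i
    rw [hE]
    dsimp only
    rw [volume_real_approxAddOrderOf (by omega) (hδ0 _) (by rw [hnδ]; exact h1 _)]
    simp only [hδ]
    ring
  have hsum : ∀ N, ∑ i ∈ Finset.range N, volume.real (E i) =
      2 * ∑ i ∈ Finset.range N, ((i + 1).totient : ℝ) / (i + 1 : ℕ) * Ψ (i + 1) := by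
    intro N
    rw [Finset.mul_sum]
    exact Finset.sum_congr rfl fun i _ => hvol i
  have hpos : ¬ ∀ᵐ x : UnitAddCircle, ¬ ∃ᶠ i in atTop, x ∈ E i := by
    have : IsProbabilityMeasure (volume : Measure UnitAddCircle) := ⟨UnitAddCircle.measure_univ⟩
    refine measure_frequently_mem_ne_zero volume hEm (K := 1 + 2 * C ^ 2) ?_ ?_
    · simp_rw [hsum]
      exact hdiv.const_mul_atTop two_pos
    · filter_upwards [hC, hdiv.eventually_ge_atTop 1] with N hN hN1
      set W := ∑ i ∈ Finset.range N, ((i + 1).totient : ℝ) / (i + 1 : ℕ) * Ψ (i + 1) with hW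
      set T := ∑ i ∈ Finset.range N, Ψ (i + 1) with hT
      have hT0 : 0 ≤ T := Finset.sum_nonneg fun i _ => h0 _
      -- The diagonal contributes the first moment, which is at most its own square once it is `≥ 1`.
      have hij : ∀ i j, volume.real (E i ∩ E j) ≤
          (if i = j then volume.real (E i) else 0) + 8 * (Ψ (i + 1) * Ψ (j + 1)) := by
        intro i j
        have hΨ : 0 ≤ 8 * (Ψ (i + 1) * Ψ (j + 1)) :=
          mul_nonneg (by norm_num) (mul_nonneg (h0 _) (h0 _))
        split_ifs with h
        · refine (measureReal_mono Set.inter_subset_left).trans ?_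
          linarith
        · have := volume_real_inter_approxAddOrderOf_le (m := i + 1) (n := j + 1) (by omega)
            (by omega) (by omega) (hδ0 (i + 1)) (hδ0 (j + 1))
          rw [hnδ, hnδ] at this
          linarith
      calc ∑ i ∈ Finset.range N, ∑ j ∈ Finset.range N, volume.real (E i ∩ E j)
          ≤ ∑ i ∈ Finset.range N, ∑ j ∈ Finset.range N,
              ((if i = j then volume.real (E i) else 0) + 8 * (Ψ (i + 1) * Ψ (j + 1))) :=
            Finset.sum_le_sum fun i _ => Finset.sum_le_sum fun j _ => hij i j
        _ = 2 * W + 8 * (T * T) := by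
            simp_rw [Finset.sum_add_distrib]
            rw [hT, Finset.sum_mul_sum, ← hsum]
            simp_rw [Finset.mul_sum]
            congr 1
            refine Finset.sum_congr rfl fun i hi => ?_
            rw [Finset.sum_ite_eq, if_pos hi]
        _ ≤ (1 + 2 * C ^ 2) * (∑ i ∈ Finset.range N, volume.real (E i)) ^ 2 := by
            rw [hsum]
            have := mul_self_le_mul_self hT0 hN
            nlinarith
  rcases AddCircle.addWellApproximable_ae_empty_or_univ (T := 1) δ hδlim with h | h
  · exact absurd (h.mono fun x hx => by rwa [← hmem x]) hpos
  · filter_upwards [h] with x hx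
    have hx' := (hmem x).1 hx
    rw [frequently_atTop] at hx' ⊢
    intro a
    obtain ⟨i, hi, hxi⟩ := hx' a
    refine ⟨i + 1, by omega, by omega, ?_⟩
    rw [mem_approx_add_orderOf_iff] at hxi
    obtain ⟨y, hy, hxy⟩ := hxi
    rw [Metric.mem_ball, dist_eq_norm] at hxy
    have hy0 : (i + 1) • y = 0 := by rw [← hy]; exact addOrderOf_nsmul_eq_zero y
    calc ‖(i + 1) • x‖ = ‖(i + 1) • (x - y)‖ := by rw [smul_sub, hy0, sub_zero]
      _ ≤ ((i + 1 : ℕ) : ℝ) * ‖x - y‖ := norm_nsmul_le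
      _ < ((i + 1 : ℕ) : ℝ) * δ (i + 1) := by gcongr
      _ = _ := hnδ i

/-! ### The mean value of `φ m / m` over integers coprime to `P` -/

theorem Finset.one_sub_sum_le_prod {ι : Type*} (s : Finset ι) {f : ι → ℝ}
    (h0 : ∀ i ∈ s, 0 ≤ f i) (h1 : ∀ i ∈ s, f i ≤ 1) :
    1 - ∑ i ∈ s, f i ≤ ∏ i ∈ s, (1 - f i) := by
  classical
  induction s using Finset.induction_on with
  | empty => simp
  | insert a s ha ih =>
    rw [Finset.sum_insert ha, Finset.prod_insert ha]
    have ih' := ih (fun i hi => h0 i (Finset.mem_insert_of_mem hi))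
      (fun i hi => h1 i (Finset.mem_insert_of_mem hi))
    have ha0 := h0 a (Finset.mem_insert_self a s)
    have ha1 := h1 a (Finset.mem_insert_self a s)
    have hs : 0 ≤ ∑ i ∈ s, f i :=
      Finset.sum_nonneg fun i hi => h0 i (Finset.mem_insert_of_mem hi)
    nlinarith [mul_le_mul_of_nonneg_left ih' (sub_nonneg.2 ha1), mul_nonneg ha0 hs]

theorem totient_div_eq_prod {n : ℕ} (hn : n ≠ 0) :
    (n.totient : ℝ) / n = ∏ q ∈ n.primeFactors, (1 - (q : ℝ)⁻¹) := by
  have h := congrArg (fun x : ℚ => (x : ℝ)) (Nat.totient_eq_mul_prod_factors n)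
  push_cast at h
  rw [h, mul_div_cancel_left₀]
  exact_mod_cast hn

theorem one_sub_sum_inv_le_totient_div {n : ℕ} (hn : n ≠ 0) :
    1 - ∑ q ∈ n.primeFactors, (q : ℝ)⁻¹ ≤ (n.totient : ℝ) / n := by
  rw [totient_div_eq_prod hn]
  refine Finset.one_sub_sum_le_prod _ (fun q _ => by positivity) fun q hq => ?_
  exact inv_le_one_of_one_le₀ (by exact_mod_cast (Nat.prime_of_mem_primeFactors hq).one_le)

/-- Such `j` form a single residue class modulo `q`, because `M` is invertible modulo `q` as soon as
one of them exists. -/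
theorem card_filter_dvd_progression_le {M q : ℕ} (J : ℕ) :
    (((Finset.range J).filter fun j => q ∣ 1 + M * j).card : ℝ) ≤ J / q + 1 := by
  have h : ((Finset.range J).filter fun j => q ∣ 1 + M * j).card ≤ J / q + 1 := by
    rw [← Finset.card_range (J / q + 1)]
    refine Finset.card_le_card_of_injOn (fun j => j / q) ?_ ?_
    · intro j hj
      have hj' : j < J := by simpa using (Finset.mem_filter.1 hj).1
      simp only [Finset.coe_range, Set.mem_Iio]
      exact Nat.lt_succ_of_le (Nat.div_le_div_right hj'.le)
    · intro i hi j hj hij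
      have hi' : q ∣ 1 + M * i := (Finset.mem_filter.1 hi).2
      have hj' : q ∣ 1 + M * j := (Finset.mem_filter.1 hj).2
      have hcop : IsCoprime (q : ℤ) M := by
        obtain ⟨a, ha⟩ := hi'
        refine ⟨a, -i, ?_⟩
        have : (1 + M * i : ℤ) = q * a := by exact_mod_cast ha
        linarith
      have hd : (q : ℤ) ∣ M * ((i : ℤ) - j) := by
        have := Int.dvd_sub (Int.natCast_dvd_natCast.2 hi') (Int.natCast_dvd_natCast.2 hj')
        push_cast at this
        have e : (M : ℤ) * ((i : ℤ) - j) = 1 + M * i - (1 + M * j) := by ring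
        rwa [e]
      have hd' : (q : ℤ) ∣ (i : ℤ) - j := hcop.dvd_of_dvd_mul_left hd
      have hmod : i % q = j % q := ((Nat.modEq_iff_dvd).2 (by
        have := (dvd_neg (α := ℤ)).2 hd'
        rwa [neg_sub] at this))
      dsimp only at hij
      rw [← Nat.div_add_mod i q, ← Nat.div_add_mod j q, hij, hmod]
  calc _ ≤ ((J / q + 1 : ℕ) : ℝ) := by exact_mod_cast h
    _ ≤ _ := by push_cast; gcongr; exact Nat.cast_div_le

theorem sum_Ico_three_inv_sq_le (X : ℕ) : ∑ q ∈ Finset.Ico 3 X, ((q : ℝ) ^ 2)⁻¹ ≤ 1 / 2 := by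
  have key : ∀ X : ℕ, 3 ≤ X → ∑ q ∈ Finset.Ico 3 X, ((q : ℝ) ^ 2)⁻¹ ≤ 1 / 2 - 1 / ((X : ℝ) - 1) := by
    intro X hX
    induction X, hX using Nat.le_induction with
    | base => norm_num
    | succ n hn ih =>
      rw [Finset.sum_Ico_succ_top hn]
      have hn' : (3 : ℝ) ≤ n := by exact_mod_cast hn
      have : ((n : ℝ) ^ 2)⁻¹ ≤ 1 / ((n : ℝ) - 1) - 1 / n := by
        rw [div_sub_div _ _ (by linarith) (by linarith), inv_eq_one_div,
          div_le_div_iff₀ (by positivity) (mul_pos (by linarith) (by linarith))]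
        nlinarith
      push_cast
      rw [add_sub_cancel_right]
      linarith
  rcases le_or_gt 3 X with h | h
  · have hX : (3 : ℝ) ≤ X := by exact_mod_cast h
    have : 0 ≤ 1 / ((X : ℝ) - 1) := by apply one_div_nonneg.2; linarith
    linarith [key X h]
  · rw [Finset.Ico_eq_empty (by omega)]; norm_num

theorem sum_Ico_three_inv_le (X : ℕ) :
    ∑ q ∈ Finset.Ico 3 (X + 1), (q : ℝ)⁻¹ ≤ 1 + Real.log X := by
  have h := harmonic_le_one_add_log X
  rw [harmonic_eq_sum_Icc] at h
  push_cast at h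
  refine le_trans (Finset.sum_le_sum_of_subset_of_nonneg ?_ fun _ _ _ => by positivity) h
  intro q hq
  simp only [Finset.mem_Ico, Finset.mem_Icc] at hq ⊢
  omega

theorem sum_sum_inv_primeFactors_progression_le {M : ℕ} (hM : 2 ∣ M) (hM0 : 0 < M) (J : ℕ) :
    ∑ j ∈ Finset.range J, ∑ q ∈ (1 + M * j).primeFactors, (q : ℝ)⁻¹ ≤
      J / 2 + (1 + Real.log (M * J : ℕ)) := by
  calc ∑ j ∈ Finset.range J, ∑ q ∈ (1 + M * j).primeFactors, (q : ℝ)⁻¹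
      ≤ ∑ j ∈ Finset.range J, ∑ q ∈ Finset.Ico 3 (M * J + 1),
          if q ∣ 1 + M * j then (q : ℝ)⁻¹ else 0 := by
        refine Finset.sum_le_sum fun j hj => ?_
        rw [← Finset.sum_filter]
        refine Finset.sum_le_sum_of_subset_of_nonneg ?_ fun _ _ _ => by positivity
        intro q hq
        have hqp := Nat.prime_of_mem_primeFactors hq
        have hqd := Nat.dvd_of_mem_primeFactors hq
        rw [Finset.mem_range] at hj
        have hle := Nat.le_of_dvd (by omega) hqd
        have hq2 : q ≠ 2 := by
          rintro rfl
          have := (Nat.dvd_add_left (hM.mul_right j)).1 hqd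
          omega
        have := hqp.two_le
        have h3 : M * j + M ≤ M * J := by rw [← Nat.mul_succ]; exact Nat.mul_le_mul_left _ hj
        simp only [Finset.mem_filter, Finset.mem_Ico]
        exact ⟨⟨by omega, by omega⟩, hqd⟩
    _ = ∑ q ∈ Finset.Ico 3 (M * J + 1),
          (((Finset.range J).filter fun j => q ∣ 1 + M * j).card : ℝ) * (q : ℝ)⁻¹ := by
        rw [Finset.sum_comm]
        refine Finset.sum_congr rfl fun q _ => ?_
        rw [← Finset.sum_filter, Finset.sum_const, nsmul_eq_mul]
    _ ≤ ∑ q ∈ Finset.Ico 3 (M * J + 1), (J * ((q : ℝ) ^ 2)⁻¹ + (q : ℝ)⁻¹) := by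
        refine Finset.sum_le_sum fun q _ => ?_
        have := card_filter_dvd_progression_le (M := M) (q := q) J
        calc _ ≤ ((J : ℝ) / q + 1) * (q : ℝ)⁻¹ := by gcongr
          _ = _ := by ring
    _ ≤ J * (1 / 2) + (1 + Real.log (M * J : ℕ)) := by
        rw [Finset.sum_add_distrib, ← Finset.mul_sum]
        gcongr
        · exact sum_Ico_three_inv_sq_le _
        · exact sum_Ico_three_inv_le _
    _ = _ := by ring

/-- The lower bound already holds over the progression `1 + 2 * P * j`. Its terms are odd, so the
expected loss from their prime factors is at most `∑ 1 / q ^ 2 ≤ 1 / 2` over `q ≥ 3`. -/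
theorem exists_mul_le_sum_totient_div_coprime {P : ℕ} (hP : 0 < P) :
    ∃ c : ℝ, 0 < c ∧ ∀ Y : ℕ,
      c * Y ≤ ∑ m ∈ (Finset.Ioc 0 Y).filter (fun m => P.Coprime m), (m.totient : ℝ) / m := by
  set M := 2 * P with hMdef
  have hM0 : 0 < M := by omega
  have hMr : (0 : ℝ) < M := by exact_mod_cast hM0
  have hnn : ∀ m : ℕ, 0 ≤ (m.totient : ℝ) / m := fun m => by positivity
  have hG : ∀ Y J : ℕ, M * J ≤ Y → (J : ℝ) / 2 - (1 + Real.log (M * J : ℕ)) ≤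
      ∑ m ∈ (Finset.Ioc 0 Y).filter (fun m => P.Coprime m), (m.totient : ℝ) / m := by
    intro Y J hJ
    calc (J : ℝ) / 2 - (1 + Real.log (M * J : ℕ))
        ≤ ∑ j ∈ Finset.range J, (1 - ∑ q ∈ (1 + M * j).primeFactors, (q : ℝ)⁻¹) := by
          rw [Finset.sum_sub_distrib]
          have := sum_sum_inv_primeFactors_progression_le (M := M) ⟨P, rfl⟩ hM0 J
          simp only [Finset.sum_const, Finset.card_range, nsmul_eq_mul, mul_one]
          linarith
      _ ≤ ∑ j ∈ Finset.range J, ((1 + M * j).totient : ℝ) / (1 + M * j : ℕ) :=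
          Finset.sum_le_sum fun j _ => one_sub_sum_inv_le_totient_div (by omega)
      _ = ∑ m ∈ (Finset.range J).image (fun j => 1 + M * j), (m.totient : ℝ) / m := by
          rw [Finset.sum_image]
          intro i _ j _ h
          exact Nat.eq_of_mul_eq_mul_left hM0 (Nat.add_left_cancel h)
      _ ≤ _ := by
          refine Finset.sum_le_sum_of_subset_of_nonneg ?_ fun _ _ _ => hnn _
          intro m hm
          obtain ⟨j, hj, rfl⟩ := Finset.mem_image.1 hm
          rw [Finset.mem_range] at hj
          have h3 : M * j + M ≤ M * J := by rw [← Nat.mul_succ]; exact Nat.mul_le_mul_left _ hj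
          simp only [Finset.mem_filter, Finset.mem_Ioc]
          refine ⟨⟨by omega, by omega⟩, ?_⟩
          rw [hMdef, mul_comm 2, mul_assoc]
          simp
  have hlog : ∀ᶠ J : ℕ in atTop, 1 + Real.log (M * J : ℕ) ≤ (J : ℝ) / 4 := by
    have h1 : Tendsto (fun J : ℕ => ((M * J : ℕ) : ℝ)) atTop atTop :=
      tendsto_natCast_atTop_atTop.comp (tendsto_id.const_mul_atTop' hM0)
    have h2 := (Real.isLittleO_log_id_atTop.comp_tendsto h1).bound
      (c := 1 / (8 * M)) (by positivity)
    filter_upwards [h2, eventually_ge_atTop 8] with J hJ hJ8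
    have hJ8' : (8 : ℝ) ≤ J := by exact_mod_cast hJ8
    simp only [Function.comp, id, Real.norm_eq_abs] at hJ
    rw [abs_of_nonneg (Nat.cast_nonneg (α := ℝ) (M * J))] at hJ
    have h3 := (le_abs_self _).trans hJ
    have h4 : 1 / (8 * (M : ℝ)) * ((M * J : ℕ) : ℝ) = J / 8 := by push_cast; field_simp
    linarith
  obtain ⟨J0, hJ0⟩ := eventually_atTop.1 hlog
  -- Below the threshold `Y0` the single term `m = 1` suffices.
  set Y0 := M * (J0 + 1) with hY0
  have hY0pos : 0 < Y0 := by positivity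
  refine ⟨min (1 / Y0) (1 / (8 * M)), lt_min (by positivity) (by positivity), fun Y => ?_⟩
  rcases Nat.eq_zero_or_pos Y with rfl | hY
  · simp
  rcases le_or_gt Y Y0 with h | h
  · have h1 : (1 : ℝ) ≤
        ∑ m ∈ (Finset.Ioc 0 Y).filter (fun m => P.Coprime m), (m.totient : ℝ) / m := by
      have := Finset.single_le_sum (f := fun m : ℕ => (m.totient : ℝ) / m) (fun m _ => hnn m)
        (show 1 ∈ (Finset.Ioc 0 Y).filter (fun m => P.Coprime m) by simp; omega)
      simpa using this
    calc _ ≤ 1 / (Y0 : ℝ) * Y := by gcongr; exact min_le_left _ _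
      _ ≤ 1 := by
        rw [one_div_mul_eq_div, div_le_one (by positivity)]
        exact_mod_cast h
      _ ≤ _ := h1
  · have hJ1 : J0 + 1 ≤ Y / M := (Nat.le_div_iff_mul_le hM0).2 (by rw [mul_comm]; exact h.le)
    have h1 := hG Y (Y / M) (Nat.mul_div_le Y M)
    have h2 := hJ0 (Y / M) (by omega)
    have h3 : (Y : ℝ) ≤ 2 * M * (Y / M : ℕ) := by
      have : Y ≤ 2 * M * (Y / M) := by
        have := Nat.div_add_mod Y M
        have := Nat.mod_lt Y hM0
        have : M ≤ M * (Y / M) := Nat.le_mul_of_pos_right _ (by omega)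
        nlinarith
      exact_mod_cast this
    calc _ ≤ 1 / (8 * (M : ℝ)) * Y := by gcongr; exact min_le_right _ _
      _ ≤ 1 / (8 * (M : ℝ)) * (2 * M * (Y / M : ℕ)) := by gcongr
      _ = ((Y / M : ℕ) : ℝ) / 4 := by field_simp; ring
      _ ≤ _ := by linarith

/-! ### Averages of the part of `n` composed of given primes -/

/-- The part of `n` composed of the primes `p i`; it is the inverse of the product of the `p i`-adic
absolute values of `n`. Its value at `n = 0` is the junk value `1`. -/
def primePart {k : ℕ} (p : Fin k → ℕ) (n : ℕ) : ℕ :=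
  ∏ i, p i ^ n.factorization (p i)

theorem factorization_prod_pow_mul {k : ℕ} {p : Fin k → ℕ} (hp : ∀ i, (p i).Prime)
    (hpinj : Function.Injective p) (v : Fin k → ℕ) {m : ℕ} (hm : (∏ i, p i).Coprime m) (i : Fin k) :
    ((∏ j, p j ^ v j) * m).factorization (p i) = v i := by
  have hcop : ∀ j, (p j).Coprime m := fun j => Nat.Coprime.of_dvd_left
    (Finset.dvd_prod_of_mem p (Finset.mem_univ j)) hm
  have hm0 : m ≠ 0 := by
    rintro rfl
    have := hcop i
    rw [Nat.coprime_zero_right] at this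
    exact (hp i).ne_one this
  have h0 : ∀ j ∈ Finset.univ, p j ^ v j ≠ 0 := fun j _ => pow_ne_zero _ (hp j).ne_zero
  rw [Nat.factorization_mul (Finset.prod_ne_zero_iff.2 h0) hm0, Finsupp.add_apply,
    Nat.factorization_prod h0, Finsupp.finsetSum_apply, Finset.sum_eq_single i,
    Nat.factorization_eq_zero_of_not_dvd fun h =>
      (hp i).ne_one ((Nat.coprime_iff_gcd_eq_one.1 (hcop i)).symm.trans (Nat.gcd_eq_left h)).symm]
  · simp [(hp i).factorization_pow]
  · intro j _ hj
    rw [(hp j).factorization_pow, Finsupp.single_apply, if_neg fun h => hj (hpinj h)]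
  · simp

theorem primePart_prod_pow_mul {k : ℕ} {p : Fin k → ℕ} (hp : ∀ i, (p i).Prime)
    (hpinj : Function.Injective p) (v : Fin k → ℕ) {m : ℕ} (hm : (∏ i, p i).Coprime m) :
    primePart p ((∏ j, p j ^ v j) * m) = ∏ j, p j ^ v j := by
  refine Finset.prod_congr rfl fun i _ => ?_
  rw [factorization_prod_pow_mul hp hpinj v hm]

theorem primePart_dvd {k : ℕ} {p : Fin k → ℕ} (hp : ∀ i, (p i).Prime)
    (hpinj : Function.Injective p) (n : ℕ) : primePart p n ∣ n := by
  refine Finset.prod_dvd_of_isRelPrime (fun i _ j _ hij => ?_) fun i _ => Nat.ordProj_dvd n (p i)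
  exact Nat.coprime_iff_isRelPrime.1
    (Nat.Coprime.pow _ _ ((Nat.coprime_primes (hp i) (hp j)).2 (hpinj.ne hij)))

theorem primePart_pos {k : ℕ} {p : Fin k → ℕ} (hp : ∀ i, (p i).Prime) (n : ℕ) :
    0 < primePart p n :=
  Finset.prod_pos fun i _ => pow_pos (hp i).pos _

/-- Each exponent vector `v` contributes at most `N`: its value `∏ i, p i ^ v i` divides at most
`N / ∏ i, p i ^ v i` of the `n`. -/
theorem sum_primePart_le {k : ℕ} {p : Fin k → ℕ} (hp : ∀ i, (p i).Prime)
    (hpinj : Function.Injective p) (N : ℕ) :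
    ∑ n ∈ Finset.Ioc 0 N, primePart p n ≤ N * ∏ i, (Nat.log (p i) N + 1) := by
  set B := Fintype.piFinset fun i => Finset.range (Nat.log (p i) N + 1) with hB
  have hcard : B.card = ∏ i, (Nat.log (p i) N + 1) := by simp [hB]
  calc ∑ n ∈ Finset.Ioc 0 N, primePart p n
      ≤ ∑ n ∈ Finset.Ioc 0 N, ∑ v ∈ B, if ∏ i, p i ^ v i ∣ n then ∏ i, p i ^ v i else 0 := by
        refine Finset.sum_le_sum fun n hn => ?_
        rw [Finset.mem_Ioc] at hn
        have hv : (fun i => n.factorization (p i)) ∈ B := by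
          rw [hB, Fintype.mem_piFinset]
          intro i
          rw [Finset.mem_range, Nat.lt_succ_iff]
          refine Nat.le_log_of_pow_le (hp i).one_lt ?_
          exact (Nat.le_of_dvd hn.1 (Nat.ordProj_dvd n (p i))).trans hn.2
        have := Finset.single_le_sum (f := fun v : Fin k → ℕ =>
          if ∏ i, p i ^ v i ∣ n then ∏ i, p i ^ v i else 0) (fun _ _ => Nat.zero_le _) hv
        refine le_trans (le_of_eq ?_) this
        exact (if_pos (primePart_dvd hp hpinj n)).symm
    _ = ∑ v ∈ B, N / (∏ i, p i ^ v i) * ∏ i, p i ^ v i := by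
        rw [Finset.sum_comm]
        refine Finset.sum_congr rfl fun v _ => ?_
        rw [← Finset.sum_filter, Finset.sum_const, Nat.Ioc_filter_dvd_card_eq_div, smul_eq_mul]
    _ ≤ ∑ v ∈ B, N := Finset.sum_le_sum fun v _ => Nat.div_mul_le_self _ _
    _ = N * ∏ i, (Nat.log (p i) N + 1) := by
        rw [Finset.sum_const, hcard, smul_eq_mul, mul_comm]

theorem inv_two_pow_le_totient_div_prod_pow {k : ℕ} {p : Fin k → ℕ} (hp : ∀ i, (p i).Prime)
    (v : Fin k → ℕ) :
    ((2 : ℝ) ^ k)⁻¹ ≤ ((∏ i, p i ^ v i).totient : ℝ) / (∏ i, p i ^ v i : ℕ) := by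
  have h0 : ∏ i, p i ^ v i ≠ 0 := Finset.prod_ne_zero_iff.2 fun i _ => pow_ne_zero _ (hp i).ne_zero
  rw [totient_div_eq_prod h0]
  have hsub : (∏ i, p i ^ v i).primeFactors ⊆ Finset.univ.image p := by
    intro q hq
    have hqp := Nat.prime_of_mem_primeFactors hq
    obtain ⟨i, _, hi⟩ := (hqp.prime.dvd_finsetProd_iff _).1 (Nat.dvd_of_mem_primeFactors hq)
    have := (Nat.prime_dvd_prime_iff_eq hqp (hp i)).1 (hqp.dvd_of_dvd_pow hi)
    exact Finset.mem_image.2 ⟨i, Finset.mem_univ i, this.symm⟩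
  have hcard : (∏ i, p i ^ v i).primeFactors.card ≤ k := by
    refine (Finset.card_le_card hsub).trans (Finset.card_image_le.trans ?_)
    simp
  calc ((2 : ℝ) ^ k)⁻¹ ≤ ((2 : ℝ) ^ (∏ i, p i ^ v i).primeFactors.card)⁻¹ := by
        gcongr; norm_num
    _ = ∏ q ∈ (∏ i, p i ^ v i).primeFactors, (2 : ℝ)⁻¹ := by
        rw [Finset.prod_const, inv_pow]
    _ ≤ _ := by
        refine Finset.prod_le_prod (fun _ _ => by norm_num) fun q hq => ?_
        have h2 : (2 : ℝ) ≤ q := by exact_mod_cast (Nat.prime_of_mem_primeFactors hq).two_le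
        have : (q : ℝ)⁻¹ ≤ 2⁻¹ := by gcongr
        linarith

/-- Only the `n = (∏ i, p i ^ v i) * m` with `p i ^ (k * v i) ≤ N` and `m` coprime to all `p i` are
counted; each such `v` contributes a positive proportion of `N`. -/
theorem exists_mul_le_sum_totient_div_mul_primePart {k : ℕ} {p : Fin k → ℕ}
    (hp : ∀ i, (p i).Prime) (hpinj : Function.Injective p) :
    ∃ c : ℝ, 0 < c ∧ ∀ N : ℕ, c * (N * ∏ i, ((Nat.log (p i) N / k + 1 : ℕ) : ℝ)) ≤
      ∑ n ∈ Finset.Ioc 0 N, (n.totient : ℝ) / n * primePart p n := by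
  obtain ⟨c, hc, hcY⟩ := exists_mul_le_sum_totient_div_coprime
    (P := ∏ i, p i) (Finset.prod_pos fun i _ => (hp i).pos)
  refine ⟨((2 : ℝ) ^ k)⁻¹ * (c / 2), by positivity, fun N => ?_⟩
  rcases Nat.eq_zero_or_pos N with rfl | hN
  · simp
  set B := Fintype.piFinset fun i => Finset.range (Nat.log (p i) N / k + 1) with hB
  set a : (Fin k → ℕ) → ℕ := fun v => ∏ i, p i ^ v i with ha
  have ha0 : ∀ v, 0 < a v := fun v => Finset.prod_pos fun i _ => pow_pos (hp i).pos _
  have hcard : (B.card : ℝ) = ∏ i, ((Nat.log (p i) N / k + 1 : ℕ) : ℝ) := by simp [hB]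
  have haN : ∀ v ∈ B, a v ≤ N := by
    intro v hv
    rw [hB, Fintype.mem_piFinset] at hv
    rcases Nat.eq_zero_or_pos k with rfl | hk
    · simp only [ha, Finset.univ_eq_empty, Finset.prod_empty]; omega
    refine (Nat.pow_le_pow_iff_left hk.ne').1 ?_
    calc a v ^ k = ∏ i, p i ^ (v i * k) := by
          rw [ha, ← Finset.prod_pow]
          exact Finset.prod_congr rfl fun i _ => (pow_mul _ _ _).symm
      _ ≤ ∏ _i : Fin k, N := by
          refine Finset.prod_le_prod' fun i _ => ?_
          have h1 := Finset.mem_range.1 (hv i)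
          have h2 : v i * k ≤ Nat.log (p i) N :=
            (Nat.mul_le_mul_right k (by omega)).trans (Nat.div_mul_le_self _ _)
          exact (Nat.pow_le_pow_right (hp i).pos h2).trans (Nat.pow_log_le_self _ hN.ne')
      _ = N ^ k := by simp
  set F : (Fin k → ℕ) → Finset ℕ := fun v =>
    (Finset.Ioc 0 (N / a v)).filter fun m => (∏ i, p i).Coprime m with hF
  have hFc : ∀ v, ∀ m ∈ F v, (∏ i, p i).Coprime m := fun v m hm => (Finset.mem_filter.1 hm).2
  have hfun : ∀ v, ∀ m ∈ F v, ((2 : ℝ) ^ k)⁻¹ * ((m.totient : ℝ) / m) * a v ≤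
      ((a v * m).totient : ℝ) / (a v * m : ℕ) * primePart p (a v * m) := by
    intro v m hm
    have hcop := hFc v m hm
    have hav : (a v).Coprime m := Nat.Coprime.prod_left fun i _ => Nat.Coprime.pow_left _
      (Nat.Coprime.of_dvd_left (Finset.dvd_prod_of_mem p (Finset.mem_univ i)) hcop)
    rw [primePart_prod_pow_mul hp hpinj v hcop, Nat.totient_mul hav]
    push_cast
    rw [mul_div_mul_comm]
    have := inv_two_pow_le_totient_div_prod_pow hp v
    push_cast at this
    simp only [ha]
    push_cast
    gcongr
  have hinj : Set.InjOn (fun x : (_ : Fin k → ℕ) × ℕ => a x.1 * x.2) (B.sigma F) := by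
    rintro ⟨v, m⟩ hx ⟨w, n⟩ hy h
    simp only [Finset.coe_sigma, Set.mem_sigma_iff, Finset.mem_coe] at hx hy h
    have hvw : v = w := by
      funext i
      rw [← factorization_prod_pow_mul hp hpinj v (hFc v m hx.2) i,
        ← factorization_prod_pow_mul hp hpinj w (hFc w n hy.2) i]
      exact congrArg (fun n : ℕ => n.factorization (p i)) h
    subst hvw
    rw [Nat.eq_of_mul_eq_mul_left (ha0 v) h]
  have hnn : ∀ n : ℕ, 0 ≤ (n.totient : ℝ) / n * primePart p n := fun n => by positivity
  calc ((2 : ℝ) ^ k)⁻¹ * (c / 2) * (N * ∏ i, ((Nat.log (p i) N / k + 1 : ℕ) : ℝ))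
      = ∑ v ∈ B, ((2 : ℝ) ^ k)⁻¹ * (c / 2) * N := by
        rw [Finset.sum_const, nsmul_eq_mul, hcard]; ring
    _ ≤ ∑ v ∈ B, ((2 : ℝ) ^ k)⁻¹ * (c * (N / a v : ℕ)) * a v := by
        refine Finset.sum_le_sum fun v hv => ?_
        have h2 : N ≤ 2 * (N / a v * a v) := by
          have h1 := Nat.div_add_mod N (a v)
          have h3 := Nat.mod_lt N (ha0 v)
          have h4 : 1 * a v ≤ N / a v * a v :=
            Nat.mul_le_mul_right _ (Nat.div_pos (haN v hv) (ha0 v))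
          rw [mul_comm (a v)] at h1
          omega
        have h2' : (N : ℝ) ≤ 2 * ((N / a v : ℕ) * a v) := by exact_mod_cast h2
        calc _ ≤ ((2 : ℝ) ^ k)⁻¹ * (c / 2) * (2 * ((N / a v : ℕ) * a v)) := by gcongr
          _ = _ := by ring
    _ ≤ ∑ v ∈ B, ((2 : ℝ) ^ k)⁻¹ * (∑ m ∈ F v, (m.totient : ℝ) / m) * a v := by
        refine Finset.sum_le_sum fun v _ => ?_
        have := hcY (N / a v)
        gcongr
    _ = ∑ v ∈ B, ∑ m ∈ F v, ((2 : ℝ) ^ k)⁻¹ * ((m.totient : ℝ) / m) * a v := by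
        simp_rw [Finset.mul_sum, Finset.sum_mul]
    _ ≤ ∑ v ∈ B, ∑ m ∈ F v, ((a v * m).totient : ℝ) / (a v * m : ℕ) * primePart p (a v * m) :=
        Finset.sum_le_sum fun v _ => Finset.sum_le_sum fun m hm => hfun v m hm
    _ = ∑ n ∈ (B.sigma F).image (fun x => a x.1 * x.2), (n.totient : ℝ) / n * primePart p n := by
        rw [Finset.sum_image hinj, Finset.sum_sigma]
    _ ≤ _ := by
        refine Finset.sum_le_sum_of_subset_of_nonneg ?_ fun _ _ _ => hnn _
        intro n hn
        obtain ⟨⟨v, m⟩, hx, rfl⟩ := Finset.mem_image.1 hn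
        have hm := (Finset.mem_filter.1 (Finset.mem_sigma.1 hx).2).1
        rw [Finset.mem_Ioc] at hm ⊢
        exact ⟨Nat.mul_pos (ha0 v) hm.1,
          (Nat.mul_le_mul_left _ hm.2).trans (Nat.mul_div_le _ _)⟩

/-! ### Comparison with sums of powers of logarithms -/

/-- Summation by parts: domination of partial sums is preserved by nonnegative decreasing weights. -/
theorem sum_mul_le_sum_mul_of_antitone {f b c : ℕ → ℝ} (hf : Antitone f) (hf0 : ∀ n, 0 ≤ f n)
    (hbc : ∀ N, ∑ i ∈ Finset.range N, b i ≤ ∑ i ∈ Finset.range N, c i) (N : ℕ) :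
    ∑ i ∈ Finset.range N, b i * f i ≤ ∑ i ∈ Finset.range N, c i * f i := by
  have key : ∀ N, f N * ∑ i ∈ Finset.range (N + 1), (c i - b i) ≤
      ∑ i ∈ Finset.range (N + 1), (c i - b i) * f i := by
    intro N
    induction N with
    | zero => simp [mul_comm]
    | succ N ih =>
      rw [Finset.sum_range_succ, Finset.sum_range_succ _ (N + 1)]
      have h1 : 0 ≤ ∑ i ∈ Finset.range (N + 1), (c i - b i) := by
        rw [Finset.sum_sub_distrib]; linarith [hbc (N + 1)]
      have h2 := mul_le_mul_of_nonneg_right (hf (Nat.le_succ N)) h1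
      have h3 : f (N + 1) * (∑ i ∈ Finset.range (N + 1), (c i - b i) + (c (N + 1) - b (N + 1))) =
        f (N + 1) * ∑ i ∈ Finset.range (N + 1), (c i - b i) +
          (c (N + 1) - b (N + 1)) * f (N + 1) := by ring
      rw [h3]
      exact add_le_add (h2.trans ih) le_rfl
  rcases N with _ | N
  · simp
  have h1 : 0 ≤ ∑ i ∈ Finset.range (N + 1), (c i - b i) := by
    rw [Finset.sum_sub_distrib]; linarith [hbc (N + 1)]
  have h2 := (mul_nonneg (hf0 N) h1).trans (key N)
  simp_rw [sub_mul] at h2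
  rw [Finset.sum_sub_distrib] at h2
  linarith

theorem sum_Ioc_zero_eq_sum_range {R : Type*} [AddCommMonoid R] (f : ℕ → R) (N : ℕ) :
    ∑ n ∈ Finset.Ioc 0 N, f n = ∑ i ∈ Finset.range N, f (i + 1) := by
  induction N with
  | zero => simp
  | succ N ih => rw [Finset.sum_range_succ, ← ih, Finset.sum_Ioc_succ_top (Nat.zero_le N)]

/-- Pairing the factors `n` and `N + 1 - n`, whose product is at least `N`, shows that one of the two
logarithms is at least `log N / 2`. -/
theorem sum_log_pow_ge (k N : ℕ) : (N : ℝ) / 2 * (Real.log N / 2) ^ k ≤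
    ∑ i ∈ Finset.range N, Real.log (i + 1 : ℕ) ^ k := by
  have hnn : ∀ n : ℕ, 0 ≤ Real.log n := Real.log_natCast_nonneg
  have h := Finset.sum_range_reflect (fun i : ℕ => Real.log (i + 1 : ℕ) ^ k) N
  have h2 : ∑ i ∈ Finset.range N, (Real.log N / 2) ^ k ≤
      ∑ i ∈ Finset.range N,
        (Real.log (N - 1 - i + 1 : ℕ) ^ k + Real.log (i + 1 : ℕ) ^ k) := by
    refine Finset.sum_le_sum fun i hi => ?_
    rw [Finset.mem_range] at hi
    have hN : N ≤ (N - 1 - i + 1) * (i + 1) := by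
      obtain ⟨j, rfl⟩ : ∃ j, N = i + j + 1 := ⟨N - i - 1, by omega⟩
      have : i + j + 1 - 1 - i = j := by omega
      rw [this]
      nlinarith
    have hlog : Real.log N ≤ Real.log (N - 1 - i + 1 : ℕ) + Real.log (i + 1 : ℕ) := by
      rw [← Real.log_mul (by positivity) (by positivity)]
      refine Real.log_le_log (by exact_mod_cast (by omega : 0 < N)) ?_
      exact_mod_cast hN
    have hLN := hnn N
    rcases le_total (Real.log N / 2) (Real.log (i + 1 : ℕ)) with h' | h'
    · have := pow_le_pow_left₀ (by positivity) h' k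
      have := pow_nonneg (hnn (N - 1 - i + 1)) k
      linarith
    · have h'' : Real.log N / 2 ≤ Real.log (N - 1 - i + 1 : ℕ) := by linarith
      have := pow_le_pow_left₀ (by positivity) h'' k
      have := pow_nonneg (hnn (i + 1)) k
      linarith
  rw [Finset.sum_add_distrib, h, Finset.sum_const, Finset.card_range, nsmul_eq_mul] at h2
  linarith

theorem sum_log_pow_le (k N : ℕ) :
    ∑ i ∈ Finset.range N, Real.log (i + 1 : ℕ) ^ k ≤ N * Real.log N ^ k := by
  calc _ ≤ ∑ i ∈ Finset.range N, Real.log N ^ k := by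
        refine Finset.sum_le_sum fun i hi => ?_
        rw [Finset.mem_range] at hi
        have h1 : ((i + 1 : ℕ) : ℝ) ≤ N := by exact_mod_cast hi
        have h2 := Real.log_le_log (by positivity) h1
        exact pow_le_pow_left₀ (Real.log_natCast_nonneg _) h2 k
    _ = _ := by simp

theorem log_le_natLog_succ_mul_log {b N : ℕ} (hb : 1 < b) :
    Real.log N ≤ ((Nat.log b N + 1 : ℕ) : ℝ) * Real.log b := by
  rcases Nat.eq_zero_or_pos N with rfl | hN
  · have := Real.log_natCast_nonneg b
    simp; positivity
  rw [← Real.log_pow]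
  refine Real.log_le_log (by exact_mod_cast hN) ?_
  exact_mod_cast (Nat.lt_pow_succ_log_self hb N).le

theorem sum_totient_div_mul_primePart_ge {k : ℕ} (hk : 1 ≤ k) {p : Fin k → ℕ}
    (hp : ∀ i, (p i).Prime) (hpinj : Function.Injective p) :
    ∃ c : ℝ, 0 < c ∧ ∀ N : ℕ, ∑ i ∈ Finset.range N, c * Real.log (i + 1 : ℕ) ^ k ≤
      ∑ i ∈ Finset.range N, ((i + 1).totient : ℝ) / (i + 1 : ℕ) * primePart p (i + 1) := by
  obtain ⟨c, hc, hcN⟩ := exists_mul_le_sum_totient_div_mul_primePart hp hpinj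
  have hlogp : ∀ i, 0 < Real.log (p i) := fun i => Real.log_pos (by exact_mod_cast (hp i).one_lt)
  have hk' : (0 : ℝ) < k := by exact_mod_cast hk
  have hD : 0 < ∏ i, (k * Real.log (p i)) := Finset.prod_pos fun i _ => mul_pos hk' (hlogp i)
  refine ⟨c / ∏ i, (k * Real.log (p i)), by positivity, fun N => ?_⟩
  rw [← sum_Ioc_zero_eq_sum_range fun n : ℕ => (n.totient : ℝ) / n * primePart p n,
    ← Finset.mul_sum]
  have hprod : Real.log N ^ k / ∏ i, (k * Real.log (p i)) ≤
      ∏ i, ((Nat.log (p i) N / k + 1 : ℕ) : ℝ) := by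
    calc Real.log N ^ k / ∏ i, (k * Real.log (p i))
        = ∏ i, (Real.log N / (k * Real.log (p i))) := by
          rw [Finset.prod_div_distrib]; simp
      _ ≤ _ := by
          refine Finset.prod_le_prod (fun i _ => div_nonneg (Real.log_natCast_nonneg N)
            (mul_pos hk' (hlogp i)).le) fun i _ => ?_
          rw [div_le_iff₀ (mul_pos hk' (hlogp i))]
          have h1 := log_le_natLog_succ_mul_log (N := N) (hp i).one_lt
          have h2 : Nat.log (p i) N + 1 ≤ (Nat.log (p i) N / k + 1) * k := by
            have := Nat.lt_mul_div_succ (Nat.log (p i) N) (by omega : 0 < k)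
            rw [mul_comm]; omega
          have h2' : ((Nat.log (p i) N + 1 : ℕ) : ℝ) ≤
              ((Nat.log (p i) N / k + 1 : ℕ) : ℝ) * k := by exact_mod_cast h2
          have := hlogp i
          calc _ ≤ _ := h1
            _ ≤ ((Nat.log (p i) N / k + 1 : ℕ) : ℝ) * k * Real.log (p i) := by gcongr
            _ = _ := by ring
  calc _ ≤ (c / ∏ i, (k * Real.log (p i))) * (N * Real.log N ^ k) :=
        mul_le_mul_of_nonneg_left (sum_log_pow_le k N) (by positivity)
    _ = c * (N * (Real.log N ^ k / ∏ i, (k * Real.log (p i)))) := by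
        generalize ∏ i, (k * Real.log (p i)) = D
        ring
    _ ≤ c * (N * ∏ i, ((Nat.log (p i) N / k + 1 : ℕ) : ℝ)) := by gcongr
    _ ≤ _ := hcN N

/-- The extra term at `i = 0` (that is, `n = 1`) is needed because `log 1 = 0`. -/
theorem sum_primePart_le_sum_log_pow {k : ℕ} {p : Fin k → ℕ}
    (hp : ∀ i, (p i).Prime) (hpinj : Function.Injective p) :
    ∃ C : ℝ, 0 < C ∧ ∀ N : ℕ, ∑ i ∈ Finset.range N, (primePart p (i + 1) : ℝ) ≤
      ∑ i ∈ Finset.range N, C * (Real.log (i + 1 : ℕ) ^ k + if i = 0 then 1 else 0) := by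
  refine ⟨2 * 8 ^ k, by positivity, fun N => ?_⟩
  have hlog2 : 1 / 2 ≤ Real.log 2 := by linarith [Real.log_two_gt_d9]
  have hupper : ∑ i ∈ Finset.range N, (primePart p (i + 1) : ℝ) ≤ N * (1 + 2 * Real.log N) ^ k := by
    have h1 : ((∑ n ∈ Finset.Ioc 0 N, primePart p n : ℕ) : ℝ) ≤
        ((N * ∏ i, (Nat.log (p i) N + 1) : ℕ) : ℝ) := by exact_mod_cast sum_primePart_le hp hpinj N
    rw [sum_Ioc_zero_eq_sum_range] at h1
    push_cast at h1
    refine h1.trans ?_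
    gcongr
    calc _ ≤ ∏ _i : Fin k, (1 + 2 * Real.log N) := by
          refine Finset.prod_le_prod (fun i _ => by positivity) fun i _ => ?_
          rcases Nat.eq_zero_or_pos N with rfl | hN
          · simp
          have h2 : p i ^ Nat.log (p i) N ≤ N := Nat.pow_log_le_self _ hN.ne'
          have h3 : Nat.log (p i) N * Real.log (p i) ≤ Real.log N := by
            rw [← Real.log_pow]
            refine Real.log_le_log ?_ (by exact_mod_cast h2)
            exact_mod_cast pow_pos (hp i).pos _
          have h4 : Real.log 2 ≤ Real.log (p i) :=
            Real.log_le_log two_pos (by exact_mod_cast (hp i).two_le)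
          have h5 : (0 : ℝ) ≤ Nat.log (p i) N := by positivity
          nlinarith
      _ = _ := by simp
  have hsplit : ∑ i ∈ Finset.range N, 2 * 8 ^ k *
      (Real.log (i + 1 : ℕ) ^ k + if i = 0 then (1 : ℝ) else 0) =
      2 * 8 ^ k * ∑ i ∈ Finset.range N, Real.log (i + 1 : ℕ) ^ k +
        2 * 8 ^ k * ∑ i ∈ Finset.range N, if i = 0 then (1 : ℝ) else 0 := by
    rw [← mul_add, ← Finset.sum_add_distrib, Finset.mul_sum]
  rw [hsplit]
  have hnn : 0 ≤ ∑ i ∈ Finset.range N, Real.log (i + 1 : ℕ) ^ k :=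
    Finset.sum_nonneg fun i _ => pow_nonneg (Real.log_natCast_nonneg _) k
  have h8 : (1 : ℝ) ≤ 8 ^ k := one_le_pow₀ (by norm_num)
  rcases Nat.lt_or_ge N 2 with h | h
  · interval_cases N
    · simp
    · have h0 := mul_nonneg (by positivity : 0 ≤ 2 * (8 : ℝ) ^ k) hnn
      have h1 : (∑ i ∈ Finset.range 1, if i = 0 then (1 : ℝ) else 0) = 1 := by simp
      have h2 : ((1 : ℕ) : ℝ) * (1 + 2 * Real.log (1 : ℕ)) ^ k = 1 := by simp
      rw [h1]
      linarith
  · have hN2 : (2 : ℝ) ≤ N := by exact_mod_cast h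
    have hL : 1 / 2 ≤ Real.log N := hlog2.trans (Real.log_le_log two_pos hN2)
    have hlast : 0 ≤ 2 * (8 : ℝ) ^ k * ∑ i ∈ Finset.range N, if i = 0 then (1 : ℝ) else 0 := by
      refine mul_nonneg (by positivity) (Finset.sum_nonneg fun i _ => ?_)
      split_ifs <;> norm_num
    calc _ ≤ (N : ℝ) * (1 + 2 * Real.log N) ^ k := hupper
      _ ≤ N * (8 * (Real.log N / 2)) ^ k := by gcongr; linarith
      _ = 2 * 8 ^ k * (N / 2 * (Real.log N / 2) ^ k) := by rw [mul_pow]; ring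
      _ ≤ 2 * 8 ^ k * ∑ i ∈ Finset.range N, Real.log (i + 1 : ℕ) ^ k := by
          have := sum_log_pow_ge k N
          gcongr
      _ ≤ _ := by linarith

/-! ### Solutions of the mixed inequality -/

theorem ae_coe_of_ae_unitAddCircle {Q : UnitAddCircle → Prop} (h : ∀ᵐ x, Q x) :
    ∀ᵐ α : ℝ, Q (α : UnitAddCircle) := by
  have h1 : ∀ z : ℤ, ∀ᵐ α : ℝ ∂(volume.restrict (Set.Ioc (z : ℝ) (z + 1))),
      Q (α : UnitAddCircle) := fun z =>
    (UnitAddCircle.measurePreserving_mk z).quasiMeasurePreserving.ae h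
  have h2 := (ae_restrict_iUnion_iff (μ := (volume : Measure ℝ))
    (fun z : ℤ => Set.Ioc (z : ℝ) (z + 1)) fun α => Q (α : UnitAddCircle)).2 h1
  rwa [iUnion_Ioc_intCast, Measure.restrict_univ] at h2

theorem mixedProd_eq {k : ℕ} {p : Fin k → ℕ} (hp : ∀ i, (p i).Prime) (α : ℝ) {n : ℕ} (hn : n ≠ 0) :
    mixedProd p α n = ‖n • (α : UnitAddCircle)‖ / primePart p n := by
  have h1 : ∀ i, ((padicNorm (p i) (n : ℚ) : ℚ) : ℝ) =
      (((p i ^ n.factorization (p i) : ℕ) : ℝ))⁻¹ := by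
    intro i
    rw [padicNorm.eq_zpow_of_nonzero (by exact_mod_cast hn), padicValRat.of_nat,
      Nat.factorization_def n (hp i), Rat.cast_zpow, Rat.cast_natCast, zpow_neg, zpow_natCast,
      Nat.cast_pow]
  have h2 : distNearestInt ((n : ℝ) * α) = ‖n • (α : UnitAddCircle)‖ := by
    rw [distNearestInt, ← AddCircle.coe_nsmul, nsmul_eq_mul, UnitAddCircle.norm_eq]
  rw [mixedProd, h2, Finset.prod_congr rfl fun i _ => h1 i, Finset.prod_inv_distrib, primePart]
  push_cast
  rw [div_eq_inv_mul]

theorem mem_mixedSolutions_iff {k : ℕ} {p : Fin k → ℕ} (hp : ∀ i, (p i).Prime) (ψ : ℕ → ℝ)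
    (α : ℝ) {n : ℕ} : n ∈ mixedSolutions p ψ α ↔
      1 ≤ n ∧ ‖n • (α : UnitAddCircle)‖ ≤ primePart p n * ψ n := by
  refine and_congr_right fun hn => ?_
  have : (0 : ℝ) < primePart p n := by exact_mod_cast primePart_pos hp n
  rw [mixedProd_eq hp α (by omega), div_le_iff₀ this, mul_comm]

theorem summable_primePart_mul {k : ℕ} {p : Fin k → ℕ} (hp : ∀ i, (p i).Prime)
    (hpinj : Function.Injective p) {ψ : ℕ → ℝ} (h0 : ∀ n, 1 ≤ n → 0 ≤ ψ n)
    (hψ : AntitoneOn ψ (Set.Ici 1)) (hsum : Summable fun n : ℕ => Real.log (n : ℝ) ^ k * ψ n) :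
    Summable fun i : ℕ => (primePart p (i + 1) : ℝ) * ψ (i + 1) := by
  obtain ⟨C, hC, hCN⟩ := sum_primePart_le_sum_log_pow hp hpinj
  have hanti : Antitone fun i => ψ (i + 1) := fun i j hij =>
    hψ (by simp) (by simp) (by omega)
  have hnn : ∀ i, 0 ≤ ψ (i + 1) := fun i => h0 _ (by omega)
  have hmaj : Summable fun i : ℕ =>
      C * (Real.log (i + 1 : ℕ) ^ k + if i = 0 then 1 else 0) * ψ (i + 1) := by
    have h1 := (summable_nat_add_iff 1).2 hsum
    have h2 : Summable fun i : ℕ => (if i = 0 then (1 : ℝ) else 0) * ψ (i + 1) := by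
      refine summable_of_ne_finset_zero (s := {0}) fun i hi => ?_
      rw [if_neg (by simpa using hi), zero_mul]
    refine ((h1.add h2).mul_left C).congr fun i => ?_
    ring
  refine summable_of_sum_range_le (c := ∑' i : ℕ,
    C * (Real.log (i + 1 : ℕ) ^ k + if i = 0 then 1 else 0) * ψ (i + 1))
    (fun i => mul_nonneg (Nat.cast_nonneg _) (hnn i)) fun N => ?_
  refine (sum_mul_le_sum_mul_of_antitone hanti hnn hCN N).trans ?_
  refine hmaj.sum_le_tsum _ fun i _ => mul_nonneg (mul_nonneg hC.le ?_) (hnn i)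
  refine add_nonneg (pow_nonneg (Real.log_natCast_nonneg _) k) ?_
  split_ifs <;> norm_num

theorem volume_norm_nsmul_le (i : ℕ) (ε : ℝ) :
    volume {x : UnitAddCircle | ‖(i + 1) • x‖ ≤ ε} ≤ ENNReal.ofReal (2 * ε) := by
  have hmp : MeasurePreserving (fun x : UnitAddCircle => (i + 1) • x) := by
    rcases i with _ | i
    · have e : (fun x : UnitAddCircle => (0 + 1) • x) = id := by ext x; simp
      rw [e]
      exact MeasurePreserving.id _
    · exact (AddCircle.ergodic_nsmul (by omega)).toMeasurePreserving
  have h : {x : UnitAddCircle | ‖(i + 1) • x‖ ≤ ε} =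
      (fun x : UnitAddCircle => (i + 1) • x) ⁻¹' Metric.closedBall 0 ε := by
    ext x; simp
  rw [h, hmp.measure_preimage measurableSet_closedBall.nullMeasurableSet,
    AddCircle.volume_closedBall]
  exact ENNReal.ofReal_le_ofReal (min_le_right _ _)

theorem ae_finite_mixedSolutions {k : ℕ} {p : Fin k → ℕ} (hp : ∀ i, (p i).Prime)
    (hpinj : Function.Injective p) {ψ : ℕ → ℝ} (h0 : ∀ n, 1 ≤ n → 0 ≤ ψ n)
    (hψ : AntitoneOn ψ (Set.Ici 1)) (hsum : Summable fun n : ℕ => Real.log (n : ℝ) ^ k * ψ n) :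
    ∀ᵐ α : ℝ, (mixedSolutions p ψ α).Finite := by
  have hS := (summable_primePart_mul hp hpinj h0 hψ hsum).mul_left 2
  have hfin : ∑' i : ℕ, volume
      {x : UnitAddCircle | ‖(i + 1) • x‖ ≤ primePart p (i + 1) * ψ (i + 1)} ≠ ⊤ := by
    refine ne_top_of_le_ne_top hS.tsum_ofReal_ne_top (ENNReal.tsum_le_tsum fun i => ?_)
    exact volume_norm_nsmul_le i _
  filter_upwards [ae_coe_of_ae_unitAddCircle (ae_eventually_notMem hfin)] with α hα
  obtain ⟨N, hN⟩ := eventually_atTop.1 hα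
  refine (Set.finite_Iic N).subset fun n hn => ?_
  rw [mem_mixedSolutions_iff hp] at hn
  obtain ⟨hn1, hn⟩ := hn
  obtain ⟨i, rfl⟩ : ∃ i, n = i + 1 := ⟨n - 1, by omega⟩
  by_contra hlt
  rw [Set.mem_Iic, not_le] at hlt
  exact hN i (by omega) hn

theorem ae_infinite_mixedSolutions {k : ℕ} (hk : 1 ≤ k) {p : Fin k → ℕ} (hp : ∀ i, (p i).Prime)
    (hpinj : Function.Injective p) {ψ : ℕ → ℝ} (h0 : ∀ n, 1 ≤ n → 0 ≤ ψ n)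
    (hψ : AntitoneOn ψ (Set.Ici 1)) (hsum : ¬ Summable fun n : ℕ => Real.log (n : ℝ) ^ k * ψ n) :
    ∀ᵐ α : ℝ, (mixedSolutions p ψ α).Infinite := by
  -- Distances to the nearest integer never exceed `1 / 2`.
  by_cases hbig : ∃ᶠ n : ℕ in atTop, 1 / 2 < primePart p n * ψ n
  · refine Eventually.of_forall fun α => ?_
    refine Nat.frequently_atTop_iff_infinite.1 ?_
    refine (hbig.and_eventually (eventually_ge_atTop 1)).mono fun n hn => ?_
    refine (mem_mixedSolutions_iff hp ψ α).2 ⟨hn.2, ?_⟩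
    have := AddCircle.norm_le_half_period (1 : ℝ) (x := n • (α : UnitAddCircle)) one_ne_zero
    rw [abs_one] at this
    exact this.trans hn.1.le
  rw [not_frequently, eventually_atTop] at hbig
  obtain ⟨n₀, hn₀⟩ := hbig
  have hanti : Antitone fun i => ψ (i + 1) := fun i j hij =>
    hψ (by simp) (by simp) (by omega)
  have hnn : ∀ i, 0 ≤ ψ (i + 1) := fun i => h0 _ (by omega)
  obtain ⟨C, hC, hCN⟩ := sum_primePart_le_sum_log_pow hp hpinj
  obtain ⟨c, hc, hcN⟩ := sum_totient_div_mul_primePart_ge hk hp hpinj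
  set T : ℕ → ℝ := fun N => ∑ i ∈ Finset.range N, Real.log (i + 1 : ℕ) ^ k * ψ (i + 1) with hTdef
  have hT : Tendsto T atTop atTop := by
    rw [hTdef, ← not_summable_iff_tendsto_nat_atTop_of_nonneg]
    · rwa [summable_nat_add_iff 1 (f := fun n : ℕ => Real.log (n : ℝ) ^ k * ψ n)]
    · exact fun i => mul_nonneg (pow_nonneg (Real.log_natCast_nonneg _) k) (hnn i)
  set w : ℕ → ℝ := fun i => ((i + 1).totient : ℝ) / (i + 1 : ℕ) with hw
  have hw0 : ∀ i, 0 ≤ w i := fun i => by positivity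
  set S : ℕ → ℝ := fun n => primePart p n * ψ n with hS
  have hS0 : ∀ i, 0 ≤ S (i + 1) := fun i => mul_nonneg (Nat.cast_nonneg _) (hnn i)
  have hupper : ∀ N, ∑ i ∈ Finset.range N, S (i + 1) ≤ C * (T N + ψ 1) := by
    intro N
    refine (sum_mul_le_sum_mul_of_antitone hanti hnn hCN N).trans ?_
    simp_rw [mul_assoc, ← Finset.mul_sum, add_mul, Finset.sum_add_distrib]
    gcongr
    calc ∑ i ∈ Finset.range N, (if i = 0 then (1 : ℝ) else 0) * ψ (i + 1)
        = ∑ i ∈ Finset.range N, if i = 0 then ψ 1 else 0 := by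
          refine Finset.sum_congr rfl fun i _ => ?_
          split_ifs with h
          · rw [h, one_mul]
          · rw [zero_mul]
      _ ≤ ψ 1 := by
          rw [Finset.sum_ite_eq' (Finset.range N) 0 (fun _ => ψ 1)]
          split_ifs
          · exact le_rfl
          · exact hnn 0
  have hlower : ∀ N, c * T N ≤ ∑ i ∈ Finset.range N, w i * S (i + 1) := by
    intro N
    have := sum_mul_le_sum_mul_of_antitone hanti hnn hcN N
    simp_rw [mul_assoc, ← Finset.mul_sum] at this
    exact this
  -- Dropping all `n < n₀` leaves `Ψ ≤ 1 / 2` and lowers the divergent sum by at most `D`.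
  set Ψ : ℕ → ℝ := fun n => if n₀ ≤ n ∧ 1 ≤ n then S n else 0 with hΨ
  have hΨ0 : ∀ n, 0 ≤ Ψ n := by
    intro n
    simp only [hΨ]
    split_ifs with h
    · exact mul_nonneg (Nat.cast_nonneg _) (h0 n h.2)
    · exact le_rfl
  have hΨhalf : ∀ n, Ψ n ≤ 1 / 2 := by
    intro n
    simp only [hΨ]
    split_ifs with h
    · exact not_lt.1 (hn₀ n h.1)
    · norm_num
  have hΨS : ∀ i, Ψ (i + 1) ≤ S (i + 1) := by
    intro i
    simp only [hΨ]
    split_ifs with h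
    · exact le_rfl
    · exact hS0 i
  set D := ∑ i ∈ Finset.range n₀, w i * S (i + 1) with hD
  have hdiff : ∀ N, ∑ i ∈ Finset.range N, w i * S (i + 1) ≤
      ∑ i ∈ Finset.range N, w i * Ψ (i + 1) + D := by
    intro N
    have h1 : ∑ i ∈ Finset.range N, (if i < n₀ then w i * S (i + 1) else 0) ≤ D := by
      rw [← Finset.sum_filter]
      refine Finset.sum_le_sum_of_subset_of_nonneg ?_ fun i _ _ => mul_nonneg (hw0 i) (hS0 i)
      intro i hi
      simpa using (Finset.mem_filter.1 hi).2
    refine le_trans ?_ (add_le_add le_rfl h1)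
    rw [← Finset.sum_add_distrib]
    refine Finset.sum_le_sum fun i _ => ?_
    simp only [hΨ]
    have := mul_nonneg (hw0 i) (hS0 i)
    split_ifs with h h' h'
    · linarith
    · simp
    · simp
    · omega
  have hW : ∀ N, c * T N - D ≤ ∑ i ∈ Finset.range N, w i * Ψ (i + 1) := fun N => by
    linarith [hlower N, hdiff N]
  have hdiv : Tendsto (fun N => ∑ i ∈ Finset.range N, w i * Ψ (i + 1)) atTop atTop := by
    refine tendsto_atTop_mono hW ?_
    exact tendsto_atTop_add_const_right _ _ (hT.const_mul_atTop hc)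
  have hDS := duffin_schaeffer hΨ0 hΨhalf hdiv (C := C * (4 / c)) (by
    filter_upwards [hT.eventually_ge_atTop (ψ 1), hdiv.eventually_ge_atTop D] with N hN1 hN2
    have h1 : ∑ i ∈ Finset.range N, Ψ (i + 1) ≤ C * (T N + ψ 1) :=
      (Finset.sum_le_sum fun i _ => hΨS i).trans (hupper N)
    have h2 : T N + ψ 1 ≤ 4 / c * ∑ i ∈ Finset.range N, w i * Ψ (i + 1) := by
      have := hW N
      rw [div_mul_eq_mul_div, le_div_iff₀ hc]
      nlinarith
    calc _ ≤ C * (T N + ψ 1) := h1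
      _ ≤ C * (4 / c * ∑ i ∈ Finset.range N, w i * Ψ (i + 1)) := by gcongr
      _ = _ := by ring)
  filter_upwards [ae_coe_of_ae_unitAddCircle hDS] with α hα
  refine Nat.frequently_atTop_iff_infinite.1 ?_
  refine hα.mono fun n hn => (mem_mixedSolutions_iff hp ψ α).2 ⟨hn.1, ?_⟩
  obtain ⟨hn, hlt⟩ := hn
  obtain ⟨i, rfl⟩ : ∃ i, n = i + 1 := ⟨n - 1, by omega⟩
  exact hlt.le.trans (hΨS i)

/-- Divergence of `∑ 1 / (n * log n)`; replacing `n` by `max n 2` avoids the junk values at `n ≤ 1`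
and keeps the terms decreasing. -/
theorem not_summable_inv_mul_log :
    ¬ Summable fun n : ℕ => ((max n 2 : ℕ) * Real.log (max n 2 : ℕ) : ℝ)⁻¹ := by
  have hlog : ∀ n : ℕ, 0 < Real.log (max n 2 : ℕ) := fun n =>
    Real.log_pos (by exact_mod_cast (by omega : 1 < max n 2))
  rw [← summable_condensed_iff_of_nonneg]
  · intro h
    have h1 := (summable_nat_add_iff 1).2 (h.mul_left (Real.log 2))
    refine Real.not_summable_natCast_inv ((summable_nat_add_iff 1).1 (h1.congr fun i => ?_))
    have hmax : max (2 ^ (i + 1)) 2 = 2 ^ (i + 1) := by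
      rw [pow_succ]
      have := Nat.one_le_two_pow (n := i)
      omega
    have h2 : Real.log 2 ≠ 0 := (Real.log_pos one_lt_two).ne'
    rw [hmax]
    push_cast
    rw [Real.log_pow]
    push_cast
    field_simp
  · exact fun n => inv_nonneg.2 (mul_nonneg (Nat.cast_nonneg _) (hlog n).le)
  · intro m n _ hmn
    have h1 : ((max m 2 : ℕ) : ℝ) ≤ (max n 2 : ℕ) := by exact_mod_cast max_le_max_right 2 hmn
    have h0 : (0 : ℝ) < (max m 2 : ℕ) := by positivity
    have := hlog m
    gcongr

theorem ae_frequently_mul_log_pow_mul_mixedProd_le {k : ℕ} (hk : 1 ≤ k) {p : Fin k → ℕ}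
    (hp : ∀ i, (p i).Prime) (hpinj : Function.Injective p) {ε : ℝ} (hε : 0 < ε) :
    ∀ᵐ α : ℝ, ∃ᶠ n : ℕ in atTop, (n : ℝ) * Real.log n ^ (k + 1) * mixedProd p α n ≤ ε := by
  -- `max n 2` makes `ε / g n` decreasing from `n = 1` on and changes nothing for `n ≥ 2`.
  set g : ℕ → ℝ := fun n => (max n 2 : ℕ) * Real.log (max n 2 : ℕ) ^ (k + 1) with hg
  have hlog : ∀ n : ℕ, 0 < Real.log (max n 2 : ℕ) := fun n =>
    Real.log_pos (by exact_mod_cast (by omega : 1 < max n 2))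
  have hg0 : ∀ n, 0 < g n := fun n =>
    mul_pos (by positivity) (pow_pos (hlog n) _)
  have hmono : Monotone g := by
    intro m n hmn
    have h1 : ((max m 2 : ℕ) : ℝ) ≤ (max n 2 : ℕ) := by exact_mod_cast max_le_max_right 2 hmn
    have h0 : (0 : ℝ) < (max m 2 : ℕ) := by positivity
    have := (hlog m).le
    simp only [hg]
    gcongr
  have hns : ¬ Summable fun n : ℕ => Real.log (n : ℝ) ^ k * (ε / g n) := by
    intro h
    refine not_summable_inv_mul_log ((summable_nat_add_iff 2).1 ?_)
    refine (((summable_nat_add_iff 2).2 h).mul_left ε⁻¹).congr fun i => ?_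
    have hmax : max (i + 2) 2 = i + 2 := by omega
    have h2 := (hlog (i + 2)).ne'
    simp only [hg]
    rw [hmax] at h2 ⊢
    field_simp
    ring
  have hinf := ae_infinite_mixedSolutions hk hp hpinj (ψ := fun n => ε / g n)
    (fun n _ => (div_pos hε (hg0 n)).le)
    (fun m _ n _ hmn => div_le_div_of_nonneg_left hε.le (hg0 m) (hmono hmn)) hns
  filter_upwards [hinf] with α hα
  have hα' : ∃ᶠ n in atTop, n ∈ mixedSolutions p (fun n => ε / g n) α :=
    Nat.frequently_atTop_iff_infinite.2 hα
  refine (hα'.and_eventually (eventually_ge_atTop 2)).mono fun n hn => ?_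
  have h1 : mixedProd p α n ≤ ε / g n := hn.1.2
  have hgn : g n = (n : ℝ) * Real.log n ^ (k + 1) := by
    simp only [hg]
    rw [max_eq_left hn.2]
  rw [le_div_iff₀ (hg0 n), hgn] at h1
  linarith

theorem mixedProd_nonneg {k : ℕ} (p : Fin k → ℕ) (α : ℝ) (n : ℕ) : 0 ≤ mixedProd p α n :=
  mul_nonneg (Finset.prod_nonneg fun i _ => by exact_mod_cast padicNorm.nonneg _) (abs_nonneg _)

theorem theorem1 (k : ℕ) (hk : 1 ≤ k) (p : Fin k → ℕ) (hp : ∀ i, (p i).Prime)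
    (hpinj : Function.Injective p) :
    (∀ ψ : ℕ → ℝ, (∀ n, 1 ≤ n → 0 ≤ ψ n) → AntitoneOn ψ (Set.Ici 1) →
      (¬ Summable (fun n : ℕ => Real.log (n : ℝ) ^ k * ψ n) →
        ∀ᵐ α : ℝ ∂volume, (mixedSolutions p ψ α).Infinite) ∧
      (Summable (fun n : ℕ => Real.log (n : ℝ) ^ k * ψ n) →
        ∀ᵐ α : ℝ ∂volume, (mixedSolutions p ψ α).Finite)) ∧
    (∀ᵐ α : ℝ ∂volume,
      liminf (fun n : ℕ =>
        (((n : ℝ) * Real.log (n : ℝ) ^ (k + 1) * mixedProd p α n : ℝ) : EReal)) atTop = 0) := by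
  refine ⟨fun ψ h0 hψ => ⟨ae_infinite_mixedSolutions hk hp hpinj h0 hψ,
    ae_finite_mixedSolutions hp hpinj h0 hψ⟩, ?_⟩
  have hall : ∀ᵐ α : ℝ, ∀ j : ℕ, ∃ᶠ n : ℕ in atTop,
      (n : ℝ) * Real.log n ^ (k + 1) * mixedProd p α n ≤ 1 / ((j : ℝ) + 1) :=
    ae_all_iff.2 fun j =>
      ae_frequently_mul_log_pow_mul_mixedProd_le hk hp hpinj (by positivity)
  filter_upwards [hall] with α hα
  refine le_antisymm ?_ ?_
  · have hlim : Tendsto (fun j : ℕ => ((1 / ((j : ℝ) + 1) : ℝ) : EReal)) atTop (nhds 0) := by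
      have := continuous_coe_real_ereal.tendsto (0 : ℝ)
      exact this.comp tendsto_one_div_add_atTop_nhds_zero_nat
    refine ge_of_tendsto' hlim fun j => ?_
    exact liminf_le_of_frequently_le' ((hα j).mono fun n hn => EReal.coe_le_coe_iff.2 hn)
  · refine le_liminf_of_le (by isBoundedDefault) (Eventually.of_forall fun n => ?_)
    refine EReal.coe_nonneg.2 (mul_nonneg (mul_nonneg (Nat.cast_nonneg n) ?_)
      (mixedProd_nonneg p α n))
    exact pow_nonneg (Real.log_natCast_nonneg n) _
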